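/- Let $d\in\mathbb{N}$ and let $k:\mathbb{R}^d\times\mathbb{R}^d\to\mathbb{R}$ be a continuous, symmetric, positive definite kernel, i.e. $\sum_{i,j=1}^n\alpha_i\alpha_j k(x_i,x_j)\ge 0$ for all $n\in\mathbb{N}$, $\alpha_i\in\mathbb{R}$, $x_i\in\mathbb{R}^d$. Let $\mathcal{H}_k$ be its reproducing kernel Hilbert space and $\mathcal{H}_k^d$ the Hilbert space of vector fields $v=(v_1,\dots,v_d)$ with $v_i\in\mathcal{H}_k$ and $\|v\|_{\mathcal{H}_k^d}^2=\sum_{i=1}^d\|v_i\|_{\mathcal{H}_k}^2$. Let $\mathcal{P}_k$ be the set of Borel probability measures $\rho$ on $\mathbb{R}^d$ that admit a smooth Lebesgue density, satisfy $\operatorname{supp}\rho=\mathbb{R}^d$ and $\int k(x,x)\,\mathrm{d}\rho(x)<\infty$. For $\rho\in\mathcal{P}_k$ put $T_{k,\rho}\phi=\int k(\cdot,y)\phi(y)\,\mathrm{d}\rho(y)$, acting componentwise on vector fields, and let $\mathcal{T}_\rho\subset\mathcal{H}_k^d$ be the closure of $\{T_{k,\rho}\nabla\phi:\phi\in C_c^\infty(\mathbb{R}^d)\}$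 in $\mathcal{H}_k^d$. For $\mu,\nu\in\mathcal{P}_k$ let $\mathcal{A}(\mu,\nu)$ be the set of pairs $(\rho,v):[0,1]\to\mathcal{P}_k\times\mathcal{H}_k^d$, Lebesgue measurable in $t$, with $\rho_0=\mu$, $\rho_1=\nu$, $\int_0^1\int_K|v_t|\,\mathrm{d}\rho_t\,\mathrm{d}t<\infty$ for every compact $K\subset\mathbb{R}^d$, and $\partial_t\rho+\nabla\cdot(\rho v)=0$ in the sense of distributions, that is, $$\int_0^1\left(\int_{\mathbb{R}^d}\partial_t\psi\,\mathrm{d}\rho_t+\int_{\mathbb{R}^d}\nabla\psi\cdot v_t\,\mathrm{d}\rho_t\right)\mathrm{d}t=\int_{\mathbb{R}^d}\psi(1,\cdot)\,\mathrm{d}\nu-\int_{\mathbb{R}^d}\psi(0,\cdot)\,\mathrm{d}\mu\qquad\text{for all }\psi\in C_c^\infty([0,1]\times\mathbb{R}^d).$$ The Stein distance $d_k(\mu,\nu)\in[0,\infty]$ is defined by $$d_k^2(\mu,\nu)=\inf\left\{\int_0^1\|v_t\|_{\mathcal{H}_k^d}^2\,\mathrm{d}t:\ (\rho,v)\in\mathcal{A}(\mu,\nu),\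 v_t\in\mathcal{T}_{\rho_t}\text{ for all }t\in[0,1]\right\}.$$ Let $\mathcal{W}_2(\mu,\nu)\in[0,\infty]$ be the quadratic Wasserstein distance, $\mathcal{W}_2^2(\mu,\nu)=\inf_\gamma\int|x-y|^2\,\mathrm{d}\gamma(x,y)$ over all couplings $\gamma$ of $\mu$ and $\nu$. Then the following hold. 1. $d_k$ is an extended metric on $\mathcal{P}_k$: for all $\mu_1,\mu_2,\mu_3\in\mathcal{P}_k$, $d_k(\mu_1,\mu_2)\ge 0$; $d_k(\mu_1,\mu_2)=d_k(\mu_2,\mu_1)$; $d_k(\mu_1,\mu_2)=0$ if and only if $\mu_1=\mu_2$; and $d_k(\mu_1,\mu_3)\le d_k(\mu_1,\mu_2)+d_k(\mu_2,\mu_3)$ (the value $+\infty$ is allowed). 2. If $k$ is bounded, then there exists a constant $C>0$ such that $\mathcal{W}_2(\mu,\nu)\le C\,d_k(\mu,\nu)$ for all $\mu,\nu\in\mathcal{P}_k$. In particular, the topology induced by $d_k$ on $\mathcal{P}_k$ is stronger than (i.e. at least as fine as) the topology of weak convergence. 3. The constraint $v_t\in\mathcal{T}_{\rho_t}$ can be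 dropped: for all $\mu,\nu\in\mathcal{P}_k$, $$d_k^2(\mu,\nu)=\inf\left\{\int_0^1\|v_t\|_{\mathcal{H}_k^d}^2\,\mathrm{d}t:\ (\rho,v)\in\mathcal{A}(\mu,\nu)\right\}.$$ -/

import Mathlib

open MeasureTheory Set
open scoped ContDiff ComplexOrder

namespace SteinGeometry

/-- The Euclidean space `ℝ^d`. -/
abbrev Euc (d : ℕ) : Type := EuclideanSpace ℝ (Fin d)

/-- A kernel `k : ℝ^d × ℝ^d → ℝ` that is continuous, symmetric and positive (semi)definite:
`∑ i, ∑ j, α i * α j * k (x i) (x j) ≥ 0` for all finite families of weights and points. -/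
structure PDKernel (d : ℕ) where
  toFun : Euc d → Euc d → ℝ
  continuous' : Continuous fun p : Euc d × Euc d => toFun p.1 p.2
  symm' : ∀ x y, toFun x y = toFun y x
  posDef' : ∀ (n : ℕ) (α : Fin n → ℝ) (x : Fin n → Euc d),
    0 ≤ ∑ i, ∑ j, α i * α j * toFun (x i) (x j)

namespace PDKernel

variable {d : ℕ}

instance : CoeFun (PDKernel d) fun _ => Euc d → Euc d → ℝ := ⟨PDKernel.toFun⟩

/-- The kernel as a matrix of (scalar) operators `ℝ →L[ℝ] ℝ`, `c ↦ k x y * c`. -/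
noncomputable def opMatrix (k : PDKernel d) : Matrix (Euc d) (Euc d) (ℝ →L[ℝ] ℝ) :=
  Matrix.of fun x y => k x y • ContinuousLinearMap.id ℝ ℝ

theorem opMatrix_apply (k : PDKernel d) (x y : Euc d) (c : ℝ) :
    k.opMatrix x y c = k x y * c := by
  simp [opMatrix]

theorem posSemidef_opMatrix (k : PDKernel d) : k.opMatrix.PosSemidef := by
  refine ((RKHS.posSemidef_tfae (K := k.opMatrix)).out 0 2 rfl rfl).mpr
    (And.intro ?_ fun vv => ?_)
  · ext x y
    refine ext_inner_right ℝ fun w => ?_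
    simp only [Matrix.conjTranspose_apply, ContinuousLinearMap.star_eq_adjoint,
      ContinuousLinearMap.adjoint_inner_left, opMatrix_apply, k.symm' x y]
    simp [mul_comm, mul_left_comm]
  · have h := k.posDef' _ (fun i => vv (vv.support.equivFin.symm i))
      (fun i => (vv.support.equivFin.symm i : Euc d))
    have e : vv.sum (fun x w => vv.sum fun x' w' => inner ℝ (k.opMatrix x' x w) w')
        = ∑ i, ∑ j, vv (vv.support.equivFin.symm i) * vv (vv.support.equivFin.symm j) *
          k (vv.support.equivFin.symm i : Euc d) (vv.support.equivFin.symm j : Euc d) := by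
      rw [vv.support.equivFin.symm.sum_comp (fun a : vv.support =>
        ∑ j, vv a * vv (vv.support.equivFin.symm j) *
          k (a : Euc d) (vv.support.equivFin.symm j : Euc d))]
      rw [Finset.sum_coe_sort vv.support (fun a : Euc d =>
        ∑ j, vv a * vv (vv.support.equivFin.symm j) *
          k (a : Euc d) (vv.support.equivFin.symm j : Euc d)), Finsupp.sum]
      refine Finset.sum_congr rfl fun a _ => ?_
      rw [vv.support.equivFin.symm.sum_comp (fun b : vv.support => vv a * vv b * k a b),
        Finset.sum_coe_sort vv.support (fun b : Euc d => vv a * vv b * k a b), Finsupp.sum]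
      refine Finset.sum_congr rfl fun b _ => ?_
      simp only [opMatrix_apply, RCLike.inner_apply, conj_trivial, k.symm' b a]
      ring
    rw [e]
    exact h

instance (k : PDKernel d) : Fact k.opMatrix.PosSemidef := ⟨k.posSemidef_opMatrix⟩

/-- The reproducing kernel Hilbert space `ℋ_k` of real functions on `ℝ^d`; for `f : k.RKHSpace`
and `x : ℝ^d`, `f x` is the value of `f` at `x`. -/
abbrev RKHSpace (k : PDKernel d) : Type := RKHS.OfKernel k.opMatrix

/-- `ℋ_k^d`: vector fields with components in `ℋ_k`, with `‖v‖² = ∑ i, ‖v i‖²`. -/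
abbrev VecRKHS (k : PDKernel d) : Type := PiLp 2 fun _ : Fin d => k.RKHSpace

end PDKernel

variable {d : ℕ}

/-- The vector field `ℝ^d → ℝ^d` represented by an element of `ℋ_k^d`. -/
noncomputable def vecField {k : PDKernel d} (v : k.VecRKHS) (x : Euc d) : Euc d :=
  WithLp.toLp 2 fun i => v i x

/-- Membership in `𝒫_k(ℝ^d)`: a smooth Lebesgue density, full support, and
`∫ k(x,x) dρ(x) < ∞`. -/
def IsPk (k : PDKernel d) (ρ : ProbabilityMeasure (Euc d)) : Prop :=
  (∃ f : Euc d → ℝ, ContDiff ℝ ∞ f ∧ (∀ x, 0 ≤ f x) ∧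
    (ρ : Measure (Euc d)) = volume.withDensity fun x => ENNReal.ofReal (f x)) ∧
  (ρ : Measure (Euc d)).support = univ ∧
  ∫⁻ x, ENNReal.ofReal (k x x) ∂(ρ : Measure (Euc d)) < ⊤

/-- The space `M = 𝒫_k(ℝ^d)`. -/
abbrev Pk (k : PDKernel d) : Type := {ρ : ProbabilityMeasure (Euc d) // IsPk k ρ}

/-- The underlying measure of an element of `𝒫_k(ℝ^d)`. -/
abbrev Pk.meas {k : PDKernel d} (ρ : Pk k) : Measure (Euc d) := (ρ.1 : Measure (Euc d))

/-- The integral operator `(T_{k,ρ} φ)(x) = ∫ k(x,y) φ(y) dρ(y)`. -/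
noncomputable def intOp (k : PDKernel d) (ρ : Pk k) (φ : Euc d → ℝ) (x : Euc d) : ℝ :=
  ∫ y, k x y * φ y ∂ρ.meas

/-- The set `T_{k,ρ} ∇ C_c^∞(ℝ^d)`, as a subset of `ℋ_k^d`; the operator acts componentwise. -/
def gradImage (k : PDKernel d) (ρ : Pk k) : Set k.VecRKHS :=
  {v | ∃ φ : Euc d → ℝ, ContDiff ℝ ∞ φ ∧ HasCompactSupport φ ∧
    ∀ (i : Fin d) (x : Euc d), v i x = intOp k ρ (fun y => gradient φ y i) x}

/-- The closure of `T_{k,ρ} ∇ C_c^∞(ℝ^d)` in `ℋ_k^d`. -/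
def tangentFields (k : PDKernel d) (ρ : Pk k) : Set k.VecRKHS := closure (gradImage k ρ)

/-- The set `𝒜(μ,ν)` of connecting curves `(ρ,v) : [0,1] → 𝒫_k(ℝ^d) × ℋ_k^d` (values at times
outside `[0,1]` are irrelevant). The continuity equation `∂_t ρ + ∇ · (ρ v) = 0` holds in the
sense of distributions, tested against `ψ ∈ C_c^∞([0,1] × ℝ^d)`, so that the end points are
attained in the weak sense as well. -/
structure IsConnecting {k : PDKernel d} (μ ν : Pk k) (ρ : ℝ → Pk k) (v : ℝ → k.VecRKHS) :
    Prop where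
  start : ρ 0 = μ
  finish : ρ 1 = ν
  aemeasurable_curve : AEMeasurable (fun t => (ρ t).meas) (volume.restrict (Icc (0 : ℝ) 1))
  aestronglyMeasurable_field : AEStronglyMeasurable v (volume.restrict (Icc (0 : ℝ) 1))
  locallyIntegrable : ∀ K : Set (Euc d), IsCompact K →
    ∫⁻ t in Icc (0 : ℝ) 1, ∫⁻ x in K, ‖vecField (v t) x‖ₑ ∂(ρ t).meas < ⊤
  continuityEquation : ∀ ψ : ℝ × Euc d → ℝ, ContDiff ℝ ∞ ψ → HasCompactSupport ψ →
    ∫ t in Icc (0 : ℝ) 1, ((∫ x, deriv (fun s => ψ (s, x)) t ∂(ρ t).meas) +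
        ∫ x, inner ℝ (gradient (fun y => ψ (t, y)) x) (vecField (v t) x) ∂(ρ t).meas)
      = (∫ x, ψ (1, x) ∂ν.meas) - ∫ x, ψ (0, x) ∂μ.meas

/-- The energy `∫_0^1 ‖v_t‖² dt` in `ℋ_k^d`, with values in `[0,∞]`. -/
noncomputable def energy {k : PDKernel d} (v : ℝ → k.VecRKHS) : ENNReal :=
  ∫⁻ t in Icc (0 : ℝ) 1, ‖v t‖ₑ ^ 2

/-- The Stein distance `d_k`, with values in `[0,∞]`: the square root of the infimum of the energy
over connecting curves with `v_t` in the closure of `T_{k,ρ_t} ∇ C_c^∞(ℝ^d)` for all `t`. -/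
noncomputable def steinDist (k : PDKernel d) (μ ν : Pk k) : ENNReal :=
  (⨅ (ρ : ℝ → Pk k) (v : ℝ → k.VecRKHS) (_ : IsConnecting μ ν ρ v)
    (_ : ∀ t ∈ Icc (0 : ℝ) 1, v t ∈ tangentFields k (ρ t)), energy v) ^ (1 / 2 : ℝ)

/-- The quadratic Wasserstein distance, with values in `[0,∞]`, as an infimum over couplings. -/
noncomputable def W2 (μ ν : Measure (Euc d)) : ENNReal :=
  (⨅ (γ : Measure (Euc d × Euc d)) (_ : γ.map Prod.fst = μ) (_ : γ.map Prod.snd = ν),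
    ∫⁻ p, edist p.1 p.2 ^ 2 ∂γ) ^ (1 / 2 : ℝ)

/-- The topology on `𝒫_k(ℝ^d)` induced by `d_k`: a set is open when it contains a `d_k`-ball of
positive radius around each of its points. -/
@[reducible]
def steinTopology (k : PDKernel d) : TopologicalSpace (Pk k) where
  IsOpen U := ∀ μ ∈ U, ∃ ε : ENNReal, 0 < ε ∧ ∀ ν, steinDist k μ ν < ε → ν ∈ U
  isOpen_univ := fun _ _ => ⟨1, one_pos, fun _ _ => mem_univ _⟩
  isOpen_inter := by
    rintro U V hU hV μ ⟨h1, h2⟩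
    obtain ⟨ε, hε, h⟩ := hU μ h1
    obtain ⟨δ, hδ, h'⟩ := hV μ h2
    exact ⟨min ε δ, lt_min hε hδ, fun ν hν =>
      ⟨h ν (hν.trans_le (min_le_left _ _)), h' ν (hν.trans_le (min_le_right _ _))⟩⟩
  isOpen_sUnion := by
    rintro S hS μ ⟨U, hU, hμ⟩
    obtain ⟨ε, hε, h⟩ := hS U hU μ hμ
    exact ⟨ε, hε, fun ν hν => ⟨U, hU, h ν hν⟩⟩

/-- The topology of weak convergence on `𝒫_k(ℝ^d)`. -/
@[reducible]
noncomputable def weakTopology (k : PDKernel d) : TopologicalSpace (Pk k) :=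
  TopologicalSpace.induced Subtype.val inferInstance

end SteinGeometry

/-! By the reproducing property, the integral of `⟪∇φ, v⟫` against `ρ` equals the `ℋ_k^d` inner
product of `T_{k,ρ}∇φ` with `v` (`integral_inner_vecField`). The weak continuity equation therefore
sees `v_t` only through its inner products with vectors of `T_{k,ρ_t}∇C_c^∞`. Projecting `v` in
`L²(0,1; ℋ_k^d)` onto the closed subspace of fields tangent at almost every time keeps the equation
and does not raise the energy (`IsFlow.exists_tangent`), so the constraint can be dropped
(`steinDist_sq`).

Without the constraint, curves can be reversed, reparametrised and concatenated freely. Symmetry is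
reversal of time. The triangle inequality is concatenation with time shares proportional to the two
lengths (`steinDist_le_add`). If the distance vanishes, testing against a fixed `φ` bounds the
difference of the integrals of `φ` by a constant times arbitrarily small square roots of energies,
and smooth test functions determine the measures (`integral_eq_of_steinDist_eq_zero`,
`Pk.ext_of_integral`).

If `|k| ≤ B`, then `|v_t(x)| ≤ √B ‖v_t‖` everywhere, so a curve of energy at most `a²` moves mass by
at most `√B a`. This is made rigorous without characteristics, by testing against a smooth front
that leaves a bounded set `A` at that speed: `μ A` is at most the `ν`-mass of the `r`-thickening of
`A` for every `r > √B a` (`IsFlow.measure_le_thickening`). On a grid of side `r` these inequalities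
are Hall's condition, and the resulting coupling moves points by at most `2r√d`
(`W2_le_of_forall_measure_le_thickening`), which bounds `W2`. The same inequalities bound the
Lévy–Prokhorov distance, hence the comparison of topologies. -/

namespace SteinGeometry

variable {d : ℕ}

/-! ### Feature maps, the reproducing property, and `T_{k,ρ}` as a Bochner integral. -/

namespace PDKernel

variable (k : PDKernel d)

/-- The canonical feature map `y ↦ k(·, y)` into `ℋ_k`. -/
noncomputable def feature (y : Euc d) : k.RKHSpace := RKHS.kerFun k.RKHSpace y 1

variable {k} in
theorem inner_feature (y : Euc d) (f : k.RKHSpace) : inner ℝ (k.feature y) f = f y := by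
  simp [feature]

theorem feature_apply (x y : Euc d) : k.feature y x = k x y := by
  simp [feature, RKHS.kerFun_apply, RKHS.OfKernel.kernel_ofKernel, opMatrix_apply]

theorem inner_feature_feature (x y : Euc d) :
    inner ℝ (k.feature x) (k.feature y) = k x y := by
  rw [inner_feature, feature_apply]

theorem diag_nonneg (x : Euc d) : 0 ≤ k x x := by
  rw [← inner_feature_feature]
  exact real_inner_self_nonneg

theorem norm_feature (x : Euc d) : ‖k.feature x‖ = √(k x x) := by
  rw [← inner_feature_feature, real_inner_self_eq_norm_sq, Real.sqrt_sq (norm_nonneg _)]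

theorem continuous_feature : Continuous k.feature := by
  rw [continuous_iff_continuousAt]
  intro y
  have key : ∀ x, ‖k.feature x - k.feature y‖ = √(k x x - 2 * k x y + k y y) := fun x => by
    rw [← Real.sqrt_sq (norm_nonneg _), norm_sub_sq_real, inner_feature_feature,
      ← real_inner_self_eq_norm_sq, ← real_inner_self_eq_norm_sq, inner_feature_feature,
      inner_feature_feature]
  rw [ContinuousAt, tendsto_iff_norm_sub_tendsto_zero]
  simp_rw [key]
  have hc : Continuous fun x => √(k x x - 2 * k x y + k y y) := by
    have h1 : Continuous fun x => k x x := k.continuous'.comp (continuous_id.prodMk continuous_id)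
    have h2 : Continuous fun x => k x y := k.continuous'.comp (continuous_id.prodMk continuous_const)
    fun_prop
  have := hc.tendsto y
  rwa [show k y y - 2 * k y y + k y y = 0 by ring, Real.sqrt_zero] at this

/-- The element of `ℋ_k^d` representing the functional `v ↦ ⟪w, v(y)⟫`. -/
noncomputable def vecFeature (y w : Euc d) : k.VecRKHS :=
  WithLp.toLp 2 fun i => w i • k.feature y

variable {k} in
theorem inner_vecFeature (y w : Euc d) (v : k.VecRKHS) :
    inner ℝ (k.vecFeature y w) v = inner ℝ w (vecField v y) := by
  simp only [vecFeature, vecField, PiLp.inner_apply, real_inner_smul_left, inner_feature,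
    RCLike.inner_apply, conj_trivial]
  exact Finset.sum_congr rfl fun i _ => mul_comm _ _

theorem vecFeature_apply_apply (y w : Euc d) (i : Fin d) (x : Euc d) :
    k.vecFeature y w i x = k x y * w i := by
  simp [vecFeature, feature_apply, mul_comm]

theorem continuous_vecFeature {X : Type*} [TopologicalSpace X] {y w : X → Euc d}
    (hy : Continuous y) (hw : Continuous w) : Continuous fun x => k.vecFeature (y x) (w x) := by
  refine (PiLp.continuous_toLp 2 _).comp (continuous_pi fun i => ?_)
  have := k.continuous_feature
  fun_prop

theorem vecFeature_zero (y : Euc d) : k.vecFeature y 0 = 0 := by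
  ext i : 1
  simp [vecFeature]

theorem vecFeature_add (y w w' : Euc d) :
    k.vecFeature y (w + w') = k.vecFeature y w + k.vecFeature y w' := by
  ext i : 1
  simp [vecFeature, add_smul]

theorem vecFeature_smul (c : ℝ) (y w : Euc d) :
    k.vecFeature y (c • w) = c • k.vecFeature y w := by
  ext i : 1
  simp [vecFeature, mul_smul]

end PDKernel

variable {k : PDKernel d}

theorem vecField_smul (c : ℝ) (v : k.VecRKHS) (x : Euc d) :
    vecField (c • v) x = c • vecField v x := by
  ext i
  simp [vecField]

/-- Cauchy–Schwarz against the feature `k(·, x)`, whose norm is `√(k x x)`; this is the only way the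
kernel controls the speed of the flow. -/
theorem norm_vecField_le (v : k.VecRKHS) (x : Euc d) :
    ‖vecField v x‖ ≤ √(k x x) * ‖v‖ := by
  rw [← Real.sqrt_sq (norm_nonneg v), ← Real.sqrt_mul (k.diag_nonneg x),
    ← Real.sqrt_sq (norm_nonneg (vecField v x))]
  refine Real.sqrt_le_sqrt ?_
  rw [EuclideanSpace.norm_sq_eq, PiLp.norm_sq_eq_of_L2, Finset.mul_sum]
  refine Finset.sum_le_sum fun i _ => ?_
  have h : |v i x| ≤ √(k x x) * ‖v i‖ := by
    rw [← k.norm_feature, ← PDKernel.inner_feature]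
    exact abs_real_inner_le_norm _ _
  calc ‖vecField v x i‖ ^ 2 = |v i x| ^ 2 := by simp [vecField]
    _ ≤ (√(k x x) * ‖v i‖) ^ 2 := by gcongr
    _ = k x x * ‖v i‖ ^ 2 := by rw [mul_pow, Real.sq_sqrt (k.diag_nonneg x)]

theorem continuous_vecField (v : k.VecRKHS) : Continuous (vecField v) := by
  have h (i : Fin d) : Continuous fun x => inner ℝ (k.feature x) (v i) :=
    k.continuous_feature.inner continuous_const
  simp_rw [PDKernel.inner_feature] at h
  exact (PiLp.continuous_toLp 2 fun _ : Fin d => ℝ).comp (continuous_pi h)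

/-- The element of `ℋ_k^d` obtained by integrating `k(·, y) w(y)` against a measure. -/
noncomputable def embed (k : PDKernel d) (m : Measure (Euc d)) (w : Euc d → Euc d) : k.VecRKHS :=
  ∫ y, k.vecFeature y (w y) ∂m

theorem integrable_vecFeature (k : PDKernel d) (m : Measure (Euc d)) [IsFiniteMeasure m]
    {w : Euc d → Euc d} (hw : Continuous w) (hc : HasCompactSupport w) :
    Integrable (fun y => k.vecFeature y (w y)) m := by
  refine Continuous.integrable_of_hasCompactSupport ?_ ?_
  · exact k.continuous_vecFeature continuous_id hw
  · refine hc.mono fun y hy => ?_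
    contrapose! hy
    simp only [Function.mem_support, not_not] at hy ⊢
    rw [hy, k.vecFeature_zero]

/-- `embed k m w` is the Riesz representative of `v ↦ ∫ ⟪w, v⟫ dm`: the Bochner integral commutes
with the inner product. -/
theorem integral_inner_vecField (m : Measure (Euc d)) [IsFiniteMeasure m]
    {w : Euc d → Euc d} (hw : Continuous w) (hc : HasCompactSupport w) (v : k.VecRKHS) :
    ∫ x, inner ℝ (w x) (vecField v x) ∂m = inner ℝ (embed k m w) v := by
  rw [embed, real_inner_comm, ← integral_inner (integrable_vecFeature k m hw hc)]
  refine integral_congr_ae (.of_forall fun x => ?_)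
  simp only
  rw [real_inner_comm (k.vecFeature x (w x)) v, PDKernel.inner_vecFeature]

theorem embed_apply_apply (m : Measure (Euc d)) [IsFiniteMeasure m]
    {w : Euc d → Euc d} (hw : Continuous w) (hc : HasCompactSupport w) (i : Fin d) (x : Euc d) :
    embed k m w i x = ∫ y, k x y * w y i ∂m := by
  rw [← PDKernel.inner_feature,
    show embed k m w i = PiLp.proj (𝕜 := ℝ) 2 (fun _ : Fin d => k.RKHSpace) i (embed k m w) from rfl,
    embed, ← ContinuousLinearMap.integral_comp_comm _ (integrable_vecFeature k m hw hc),
    ← integral_inner (ContinuousLinearMap.integrable_comp _ (integrable_vecFeature k m hw hc))]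
  refine integral_congr_ae (.of_forall fun y => ?_)
  simp only [PiLp.proj_apply, PDKernel.inner_feature, PDKernel.vecFeature_apply_apply]

theorem _root_.ContDiff.continuous_gradient' {φ : Euc d → ℝ} (h : ContDiff ℝ ∞ φ) :
    Continuous (gradient φ) :=
  (InnerProductSpace.toDual ℝ (Euc d)).symm.continuous.comp (h.continuous_fderiv (by simp))

theorem _root_.HasCompactSupport.gradient' {φ : Euc d → ℝ} (h : HasCompactSupport φ) :
    HasCompactSupport (gradient φ) :=
  (h.fderiv ℝ).comp_left (g := (InnerProductSpace.toDual ℝ (Euc d)).symm) (map_zero _)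

/-- An element of an RKHS is determined by its values, so the pointwise description of `T_{k,ρ}∇φ`
agrees with the Bochner integral. -/
theorem mem_gradImage_iff (ρ : Pk k) (v : k.VecRKHS) :
    v ∈ gradImage k ρ ↔ ∃ φ : Euc d → ℝ, ContDiff ℝ ∞ φ ∧ HasCompactSupport φ ∧
      v = embed k ρ.meas (gradient φ) := by
  refine exists_congr fun φ => and_congr_right fun h => and_congr_right fun hc => ?_
  simp only [← embed_apply_apply ρ.meas h.continuous_gradient' hc.gradient', intOp]
  constructor
  · intro H
    ext i : 1
    exact RKHS.ext (H i)
  · rintro rfl i x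
    rfl

/-- The set `T_{k,ρ} ∇ C_c^∞(ℝ^d)` as a linear subspace of `ℋ_k^d`. -/
noncomputable def gradSubmodule (k : PDKernel d) (ρ : Pk k) : Submodule ℝ k.VecRKHS where
  carrier := gradImage k ρ
  zero_mem' := by
    rw [mem_gradImage_iff]
    refine ⟨0, contDiff_const, HasCompactSupport.zero, ?_⟩
    have : gradient (0 : Euc d → ℝ) = 0 := by ext1 x; exact gradient_const x 0
    simp [embed, this, PDKernel.vecFeature_zero]
  add_mem' := by
    intro a b ha hb
    rw [mem_gradImage_iff] at *
    obtain ⟨φ, h1, h2, rfl⟩ := ha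
    obtain ⟨φ', h1', h2', rfl⟩ := hb
    refine ⟨φ + φ', h1.add h1', h2.add h2', ?_⟩
    have : gradient (φ + φ') = gradient φ + gradient φ' := by
      ext1 x
      simp [gradient, fderiv_add ((h1.differentiable (by simp)) x)
        ((h1'.differentiable (by simp)) x)]
    rw [this, embed, embed, embed, ← integral_add
      (integrable_vecFeature k _ h1.continuous_gradient' h2.gradient')
      (integrable_vecFeature k _ h1'.continuous_gradient' h2'.gradient')]
    simp [PDKernel.vecFeature_add]
  smul_mem' := by
    intro c a ha
    rw [mem_gradImage_iff] at *
    obtain ⟨φ, h1, h2, rfl⟩ := ha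
    refine ⟨c • φ, h1.const_smul c, h2.smul_left, ?_⟩
    have : gradient (c • φ) = c • gradient φ := by
      ext1 x
      simp [gradient, fderiv_const_smul ((h1.differentiable (by simp)) x)]
    rw [this, embed, embed, ← integral_smul]
    simp [PDKernel.vecFeature_smul]

end SteinGeometry

/-! ### Measurability and integrability along curves; flows of finite energy. -/

namespace SteinGeometry

variable {d : ℕ}

theorem aestronglyMeasurable_integral_curve {E : Type*} [NormedAddCommGroup E] [NormedSpace ℝ E]
    {m : Measure ℝ} {ρ : ℝ → Measure (Euc d)} [∀ t, IsProbabilityMeasure (ρ t)]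
    (hρ : AEMeasurable ρ m) {F : ℝ × Euc d → E} (hF : Continuous F) :
    AEStronglyMeasurable (fun t => ∫ y, F (t, y) ∂ρ t) m := by
  classical
  have hs : MeasurableSet {t | hρ.mk ρ t univ = 1} :=
    (Measure.measurable_coe MeasurableSet.univ).comp hρ.measurable_mk (measurableSet_singleton 1)
  -- The measurable representative may fail to be a probability measure on a null set of times. A
  -- Dirac mass there turns the curve into a Markov kernel.
  let r : ℝ → Measure (Euc d) :=
    {t | hρ.mk ρ t univ = 1}.piecewise (hρ.mk ρ) fun _ => Measure.dirac 0
  let κ : ProbabilityTheory.Kernel ℝ (Euc d) :=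
    ⟨r, hρ.measurable_mk.piecewise hs measurable_const⟩
  have : ProbabilityTheory.IsMarkovKernel κ := by
    refine ⟨fun t => ⟨?_⟩⟩
    change r t univ = 1
    by_cases ht : hρ.mk ρ t univ = 1
    · simp [r, ht]
    · simp [r, ht]
  refine ⟨fun t => ∫ y, F (t, y) ∂κ t,
    hF.stronglyMeasurable.integral_kernel_prod_right' (κ := κ), ?_⟩
  filter_upwards [hρ.ae_eq_mk] with t ht
  have : κ t = ρ t := by
    change r t = ρ t
    simp [r, ← ht]
  rw [this]

section Slices

variable {ψ : ℝ × Euc d → ℝ}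

theorem deriv_slice (hψ : ContDiff ℝ ∞ ψ) (t : ℝ) (x : Euc d) :
    deriv (fun s => ψ (s, x)) t = fderiv ℝ ψ (t, x) (1, 0) := by
  have h1 : HasFDerivAt ψ (fderiv ℝ ψ (t, x)) (t, x) :=
    ((hψ.differentiable (by simp)) _).hasFDerivAt
  exact (h1.comp_hasDerivAt t ((hasDerivAt_id t).prodMk (hasDerivAt_const t x))).deriv

theorem gradient_slice (hψ : ContDiff ℝ ∞ ψ) (t : ℝ) (x : Euc d) :
    gradient (fun y => ψ (t, y)) x = (InnerProductSpace.toDual ℝ (Euc d)).symm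
      ((fderiv ℝ ψ (t, x)).comp (ContinuousLinearMap.inr ℝ ℝ (Euc d))) := by
  have h1 : HasFDerivAt ψ (fderiv ℝ ψ (t, x)) (t, x) :=
    ((hψ.differentiable (by simp)) _).hasFDerivAt
  have h2 : HasFDerivAt (fun y => ψ (t, y)) _ x := h1.comp x (hasFDerivAt_prodMk_right t x)
  rw [gradient, h2.fderiv]

theorem continuous_deriv_slice (hψ : ContDiff ℝ ∞ ψ) :
    Continuous fun p : ℝ × Euc d => deriv (fun s => ψ (s, p.2)) p.1 := by
  simp_rw [deriv_slice hψ]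
  exact (hψ.continuous_fderiv (by simp)).clm_apply continuous_const

theorem hasCompactSupport_deriv_slice (hψ : ContDiff ℝ ∞ ψ) (hc : HasCompactSupport ψ) :
    HasCompactSupport fun p : ℝ × Euc d => deriv (fun s => ψ (s, p.2)) p.1 := by
  simp_rw [deriv_slice hψ]
  exact (hc.fderiv ℝ).comp_left (g := fun L : ℝ × Euc d →L[ℝ] ℝ => L (1, 0)) (by simp)

theorem continuous_gradient_slice (hψ : ContDiff ℝ ∞ ψ) :
    Continuous fun p : ℝ × Euc d => gradient (fun y => ψ (p.1, y)) p.2 := by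
  simp_rw [gradient_slice hψ]
  exact (InnerProductSpace.toDual ℝ (Euc d)).symm.continuous.comp
    ((hψ.continuous_fderiv (by simp)).clm_comp continuous_const)

theorem hasCompactSupport_gradient_slice (hψ : ContDiff ℝ ∞ ψ) (hc : HasCompactSupport ψ) :
    HasCompactSupport fun p : ℝ × Euc d => gradient (fun y => ψ (p.1, y)) p.2 := by
  simp_rw [gradient_slice hψ]
  exact (hc.fderiv ℝ).comp_left (g := fun L : ℝ × Euc d →L[ℝ] ℝ =>
    (InnerProductSpace.toDual ℝ (Euc d)).symm
      (L.comp (ContinuousLinearMap.inr ℝ ℝ (Euc d)))) (by simp)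

theorem contDiff_slice (hψ : ContDiff ℝ ∞ ψ) (t : ℝ) : ContDiff ℝ ∞ fun y => ψ (t, y) :=
  hψ.comp (contDiff_const.prodMk contDiff_id)

theorem _root_.HasCompactSupport.slice {E : Type*} [Zero E] {F : ℝ × Euc d → E}
    (hc : HasCompactSupport F) (t : ℝ) : HasCompactSupport fun y => F (t, y) := by
  refine HasCompactSupport.intro (hc.isCompact.image continuous_snd) fun y hy => ?_
  by_contra h
  exact hy ⟨(t, y), subset_tsupport _ h, rfl⟩

end Slices

variable {k : PDKernel d}

/-- The time integrand of the weak continuity equation. -/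
noncomputable def contIntegrand (ρ : ℝ → Pk k) (v : ℝ → k.VecRKHS) (ψ : ℝ × Euc d → ℝ)
    (t : ℝ) : ℝ :=
  (∫ x, deriv (fun s => ψ (s, x)) t ∂(ρ t).meas) +
    ∫ x, inner ℝ (gradient (fun y => ψ (t, y)) x) (vecField (v t) x) ∂(ρ t).meas

/-- The curve `t ↦ T_{k,ρ_t} ∇ψ(t, ·)` in `ℋ_k^d`. -/
noncomputable def gradCurve (ρ : ℝ → Pk k) (ψ : ℝ × Euc d → ℝ) (t : ℝ) : k.VecRKHS :=
  embed k (ρ t).meas (gradient fun y => ψ (t, y))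

theorem gradCurve_mem (ρ : ℝ → Pk k) {ψ : ℝ × Euc d → ℝ} (hψ : ContDiff ℝ ∞ ψ)
    (hc : HasCompactSupport ψ) (t : ℝ) : gradCurve ρ ψ t ∈ gradImage k (ρ t) :=
  (mem_gradImage_iff _ _).2 ⟨_, contDiff_slice hψ t, hc.slice t, rfl⟩

theorem contIntegrand_eq (ρ : ℝ → Pk k) (v : ℝ → k.VecRKHS) {ψ : ℝ × Euc d → ℝ}
    (hψ : ContDiff ℝ ∞ ψ) (hc : HasCompactSupport ψ) (t : ℝ) :
    contIntegrand ρ v ψ t =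
      (∫ x, deriv (fun s => ψ (s, x)) t ∂(ρ t).meas) + inner ℝ (gradCurve ρ ψ t) (v t) := by
  rw [contIntegrand, integral_inner_vecField _ (contDiff_slice hψ t).continuous_gradient'
    (hc.slice t).gradient', gradCurve]

theorem norm_integral_le_of_bound {E : Type*} [NormedAddCommGroup E] [NormedSpace ℝ E]
    (ρ : Pk k) {f : Euc d → E} {C : ℝ} (h : ∀ x, ‖f x‖ ≤ C) : ‖∫ x, f x ∂ρ.meas‖ ≤ C := by
  simpa using norm_integral_le_of_norm_le_const (μ := ρ.meas) (.of_forall h)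

theorem aestronglyMeasurable_gradCurve {m : Measure ℝ} {ρ : ℝ → Pk k}
    (hρ : AEMeasurable (fun t => (ρ t).meas) m) {ψ : ℝ × Euc d → ℝ} (hψ : ContDiff ℝ ∞ ψ) :
    AEStronglyMeasurable (gradCurve ρ ψ) m :=
  aestronglyMeasurable_integral_curve hρ
    (F := fun p => k.vecFeature p.2 (gradient (fun y => ψ (p.1, y)) p.2))
    (k.continuous_vecFeature continuous_snd (continuous_gradient_slice hψ))

/-- The integrand is continuous with compact support and every `ρ t` has mass one, so the bound is
uniform over all curves `ρ`. This uniformity is what separates points in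
`integral_eq_of_steinDist_eq_zero`. -/
theorem exists_norm_gradCurve_le (k : PDKernel d) {ψ : ℝ × Euc d → ℝ} (hψ : ContDiff ℝ ∞ ψ)
    (hc : HasCompactSupport ψ) : ∃ C, ∀ (ρ : ℝ → Pk k) (t : ℝ), ‖gradCurve ρ ψ t‖ ≤ C := by
  obtain ⟨C, hC⟩ := (k.continuous_vecFeature continuous_snd
    (continuous_gradient_slice hψ)).bounded_above_of_compact_support
    ((hasCompactSupport_gradient_slice hψ hc).mono fun p hp => by
      contrapose! hp
      simp only [Function.mem_support, not_not] at hp ⊢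
      rw [hp, k.vecFeature_zero])
  exact ⟨C, fun ρ t => norm_integral_le_of_bound (ρ t) fun x => hC (t, x)⟩

theorem memLp_gradCurve {m : Measure ℝ} [IsFiniteMeasure m] {ρ : ℝ → Pk k}
    (hρ : AEMeasurable (fun t => (ρ t).meas) m) {ψ : ℝ × Euc d → ℝ} (hψ : ContDiff ℝ ∞ ψ)
    (hc : HasCompactSupport ψ) : MemLp (gradCurve ρ ψ) 2 m := by
  obtain ⟨C, hC⟩ := exists_norm_gradCurve_le k hψ hc
  exact MemLp.of_bound (aestronglyMeasurable_gradCurve hρ hψ) C (.of_forall (hC ρ))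

theorem integrable_inner_gradCurve {m : Measure ℝ} [IsFiniteMeasure m] {ρ : ℝ → Pk k}
    (hρ : AEMeasurable (fun t => (ρ t).meas) m) {v : ℝ → k.VecRKHS} (hv : MemLp v 2 m)
    {ψ : ℝ × Euc d → ℝ} (hψ : ContDiff ℝ ∞ ψ) (hc : HasCompactSupport ψ) :
    Integrable (fun t => inner ℝ (gradCurve ρ ψ t) (v t)) m := by
  obtain ⟨C, hC⟩ := exists_norm_gradCurve_le k hψ hc
  refine ((hv.integrable (by norm_num)).norm.const_mul C).mono'
    ((aestronglyMeasurable_gradCurve hρ hψ).inner hv.1) (.of_forall fun t => ?_)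
  exact (norm_inner_le_norm _ _).trans (mul_le_mul_of_nonneg_right (hC ρ t) (norm_nonneg _))

theorem integrable_deriv_slice {m : Measure ℝ} [IsFiniteMeasure m] {ρ : ℝ → Pk k}
    (hρ : AEMeasurable (fun t => (ρ t).meas) m)
    {ψ : ℝ × Euc d → ℝ} (hψ : ContDiff ℝ ∞ ψ) (hc : HasCompactSupport ψ) :
    Integrable (fun t => ∫ x, deriv (fun s => ψ (s, x)) t ∂(ρ t).meas) m := by
  obtain ⟨C, hC⟩ := (continuous_deriv_slice hψ).bounded_above_of_compact_support
    (hasCompactSupport_deriv_slice hψ hc)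
  exact Integrable.of_bound (aestronglyMeasurable_integral_curve hρ (continuous_deriv_slice hψ)) C
    (.of_forall fun t => norm_integral_le_of_bound (ρ t) fun x => hC (t, x))

theorem integrable_contIntegrand {m : Measure ℝ} [IsFiniteMeasure m] {ρ : ℝ → Pk k}
    (hρ : AEMeasurable (fun t => (ρ t).meas) m) {v : ℝ → k.VecRKHS} (hv : MemLp v 2 m)
    {ψ : ℝ × Euc d → ℝ} (hψ : ContDiff ℝ ∞ ψ) (hc : HasCompactSupport ψ) :
    Integrable (contIntegrand ρ v ψ) m := by
  simp_rw [funext (contIntegrand_eq ρ v hψ hc)]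
  exact (integrable_deriv_slice hρ hψ hc).add (integrable_inner_gradCurve hρ hv hψ hc)

/-- Curves of finite energy solving the continuity equation on the time interval between `a` and
`b`. -/
structure IsFlow (μ ν : Pk k) (ρ : ℝ → Pk k) (v : ℝ → k.VecRKHS) (a b : ℝ) : Prop where
  start : ρ a = μ
  finish : ρ b = ν
  aemeasurable : AEMeasurable (fun t => (ρ t).meas) (volume.restrict (uIcc a b))
  memLp : MemLp v 2 (volume.restrict (uIcc a b))
  equation : ∀ ψ : ℝ × Euc d → ℝ, ContDiff ℝ ∞ ψ → HasCompactSupport ψ →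
    ∫ t in a..b, contIntegrand ρ v ψ t = (∫ x, ψ (b, x) ∂ν.meas) - ∫ x, ψ (a, x) ∂μ.meas

/-- The energy of a curve of vector fields over the time interval between `a` and `b`. -/
noncomputable def energyOn (v : ℝ → k.VecRKHS) (a b : ℝ) : ENNReal :=
  ∫⁻ t in uIcc a b, ‖v t‖ₑ ^ 2

theorem energyOn_zero_one (v : ℝ → k.VecRKHS) : energyOn v 0 1 = energy v := by
  rw [energyOn, energy, uIcc_of_le zero_le_one]

theorem memLp_two_iff {v : ℝ → k.VecRKHS} {m : Measure ℝ} :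
    MemLp v 2 m ↔ AEStronglyMeasurable v m ∧ ∫⁻ t, ‖v t‖ₑ ^ 2 ∂m < ⊤ := by
  refine and_congr_right fun _ => ?_
  rw [eLpNorm_lt_top_iff_lintegral_rpow_enorm_lt_top (by simp) (by simp)]
  simp

theorem exists_diag_le (k : PDKernel d) {K : Set (Euc d)} (hK : IsCompact K) :
    ∃ C, ∀ x ∈ K, √(k x x) ≤ C := by
  have h1 : Continuous fun x => √(k x x) :=
    (k.continuous'.comp (continuous_id.prodMk continuous_id)).sqrt
  obtain ⟨C, hC⟩ := hK.exists_bound_of_continuousOn h1.continuousOn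
  exact ⟨C, fun x hx => (le_abs_self _).trans (hC x hx)⟩

/-- Evaluation is uniformly bounded on compact sets, so finite energy implies the local
integrability demanded by `IsConnecting`; `IsFlow` can omit it. -/
theorem lintegral_enorm_vecField_lt_top {m : Measure ℝ} [IsFiniteMeasure m] (ρ : ℝ → Pk k)
    {v : ℝ → k.VecRKHS} (hv : MemLp v 2 m) {K : Set (Euc d)} (hK : IsCompact K) :
    ∫⁻ t, ∫⁻ x in K, ‖vecField (v t) x‖ₑ ∂(ρ t).meas ∂m < ⊤ := by
  obtain ⟨C, hC⟩ := exists_diag_le k hK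
  have h1 : ∀ t, ∫⁻ x in K, ‖vecField (v t) x‖ₑ ∂(ρ t).meas ≤ ENNReal.ofReal C * ‖v t‖ₑ := by
    intro t
    calc ∫⁻ x in K, ‖vecField (v t) x‖ₑ ∂(ρ t).meas
        ≤ ∫⁻ x in K, ENNReal.ofReal C * ‖v t‖ₑ ∂(ρ t).meas := by
          refine setLIntegral_mono' hK.measurableSet fun x hx => ?_
          rw [← ofReal_norm, ← ofReal_norm,
            ← ENNReal.ofReal_mul ((Real.sqrt_nonneg _).trans (hC x hx))]
          exact ENNReal.ofReal_le_ofReal ((norm_vecField_le _ _).trans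
            (mul_le_mul_of_nonneg_right (hC x hx) (norm_nonneg _)))
      _ ≤ ENNReal.ofReal C * ‖v t‖ₑ := by
          rw [setLIntegral_const]
          exact mul_le_of_le_one_right' prob_le_one
  refine (lintegral_mono h1).trans_lt ?_
  rw [lintegral_const_mul' _ _ ENNReal.ofReal_ne_top]
  exact ENNReal.mul_lt_top ENNReal.ofReal_lt_top (hv.integrable (by norm_num)).2

theorem isFlow_iff {μ ν : Pk k} {ρ : ℝ → Pk k} {v : ℝ → k.VecRKHS} :
    IsFlow μ ν ρ v 0 1 ↔ IsConnecting μ ν ρ v ∧ energy v < ⊤ := by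
  have hI : uIcc (0 : ℝ) 1 = Icc 0 1 := uIcc_of_le zero_le_one
  have hint (ψ : ℝ × Euc d → ℝ) : ∫ t in (0 : ℝ)..1, contIntegrand ρ v ψ t =
      ∫ t in Icc (0 : ℝ) 1, contIntegrand ρ v ψ t := by
    rw [intervalIntegral.integral_of_le zero_le_one, integral_Icc_eq_integral_Ioc]
  constructor
  · rintro ⟨h1, h2, h3, h4, h5⟩
    rw [hI] at h3 h4
    refine ⟨⟨h1, h2, h3, h4.1, fun K hK => lintegral_enorm_vecField_lt_top ρ h4 hK,
      fun ψ hψ hc => ?_⟩, (memLp_two_iff.1 h4).2⟩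
    rw [← h5 ψ hψ hc, hint]
    rfl
  · rintro ⟨⟨h1, h2, h3, h4, -, h5⟩, he⟩
    refine ⟨h1, h2, by rwa [hI], by rw [hI]; exact memLp_two_iff.2 ⟨h4, he⟩, fun ψ hψ hc => ?_⟩
    rw [← h5 ψ hψ hc, hint]
    rfl

end SteinGeometry

/-! ### Affine time changes, reversal and concatenation of flows. -/

namespace SteinGeometry

variable {d : ℕ} {k : PDKernel d} {μ ν κ : Pk k} {ρ ρ' : ℝ → Pk k} {v v' : ℝ → k.VecRKHS}
  {a b c e : ℝ}

theorem map_affine_volume (hc : c ≠ 0) (e : ℝ) :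
    Measure.map (fun t : ℝ => c * t + e) volume = ENNReal.ofReal |c⁻¹| • volume := by
  have : (fun t : ℝ => c * t + e) = (fun t => t + e) ∘ fun t => c * t := rfl
  rw [this, ← Measure.map_map (by fun_prop) (by fun_prop), Real.map_volume_mul_left hc,
    Measure.map_smul, (measurePreserving_add_right volume e).map_eq]

theorem preimage_affine_uIcc (hc : c ≠ 0) (a b e : ℝ) :
    (fun t : ℝ => c * t + e) ⁻¹' uIcc (c * a + e) (c * b + e) = uIcc a b := by
  ext t
  simp only [mem_preimage, mem_uIcc, add_le_add_iff_right]
  rcases hc.lt_or_gt with h | h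
  · simp only [mul_le_mul_left_of_neg h]
    tauto
  · simp only [mul_le_mul_iff_right₀ h]

theorem map_affine_restrict (hc : c ≠ 0) (a b e : ℝ) :
    Measure.map (fun t : ℝ => c * t + e) (volume.restrict (uIcc a b)) =
      ENNReal.ofReal |c⁻¹| • volume.restrict (uIcc (c * a + e) (c * b + e)) := by
  rw [← preimage_affine_uIcc hc a b e, ← Measure.restrict_map (by fun_prop) measurableSet_uIcc,
    map_affine_volume hc, Measure.restrict_smul]

/-- The test function is transported by the inverse time change. Both terms gain a factor `c`, one
from the chain rule and one from the rescaled field. -/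
theorem contIntegrand_affine (hc : c ≠ 0) (e : ℝ) (ρ : ℝ → Pk k) (v : ℝ → k.VecRKHS)
    {ψ : ℝ × Euc d → ℝ} (hψ : ContDiff ℝ ∞ ψ) (t : ℝ) :
    contIntegrand (fun t => ρ (c * t + e)) (fun t => c • v (c * t + e)) ψ t =
      c * contIntegrand ρ v (fun p => ψ (c⁻¹ * (p.1 - e), p.2)) (c * t + e) := by
  have ht : c⁻¹ * (c * t + e - e) = t := by field_simp; ring
  have hd (x : Euc d) : c * deriv (fun s => ψ (c⁻¹ * (s - e), x)) (c * t + e) =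
      deriv (fun s => ψ (s, x)) t := by
    have h1 : HasDerivAt (fun s => ψ (s, x)) (deriv (fun s => ψ (s, x)) t)
        (c⁻¹ * (c * t + e - e)) := by
      rw [ht]
      have : ContDiff ℝ ∞ fun s => ψ (s, x) := hψ.comp (contDiff_id.prodMk contDiff_const)
      exact (this.differentiable (by simp) t).hasDerivAt
    have h2 : HasDerivAt (fun s : ℝ => c⁻¹ * (s - e)) (c⁻¹ * 1) (c * t + e) :=
      ((hasDerivAt_id _).sub_const e).const_mul _
    have h3 := (h1.comp (c * t + e) h2).deriv
    rw [Function.comp_def] at h3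
    rw [h3]
    field_simp
  simp only [contIntegrand, ht]
  rw [mul_add, ← integral_const_mul, ← integral_const_mul]
  simp only [hd, vecField_smul, real_inner_smul_right]

theorem IsFlow.affine (hc : c ≠ 0) (h : IsFlow μ ν ρ v (c * a + e) (c * b + e)) :
    IsFlow μ ν (fun t => ρ (c * t + e)) (fun t => c • v (c * t + e)) a b := by
  have hm : Measurable fun t : ℝ => c * t + e := by fun_prop
  refine ⟨h.start, h.finish, ?_, ?_, fun ψ hψ hcs => ?_⟩
  · refine AEMeasurable.comp_measurable (g := fun t => (ρ t).meas) ?_ hm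
    rw [map_affine_restrict hc]
    exact h.aemeasurable.smul_measure _
  · refine MemLp.const_smul ?_ c
    have h1 : MemLp v 2 (Measure.map (fun t : ℝ => c * t + e) (volume.restrict (uIcc a b))) := by
      rw [map_affine_restrict hc]
      exact h.memLp.smul_measure ENNReal.ofReal_ne_top
    exact (memLp_map_measure_iff h1.1 hm.aemeasurable).1 h1
  · have hψ' : ContDiff ℝ ∞ fun p : ℝ × Euc d => ψ (c⁻¹ * (p.1 - e), p.2) :=
      hψ.comp ((contDiff_const.mul (contDiff_fst.sub contDiff_const)).prodMk contDiff_snd)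
    have hcs' : HasCompactSupport fun p : ℝ × Euc d => ψ (c⁻¹ * (p.1 - e), p.2) := by
      refine HasCompactSupport.intro (K := (fun p : ℝ × Euc d => (c * p.1 + e, p.2)) '' tsupport ψ)
        (hcs.isCompact.image (by fun_prop)) fun p hp => ?_
      by_contra hne
      refine hp ⟨_, subset_tsupport _ hne, ?_⟩
      ext1
      · simp only
        field_simp
        ring
      · rfl
    have h1 := h.equation _ hψ' hcs'
    have h2 (s : ℝ) : c⁻¹ * (c * s + e - e) = s := by field_simp; ring
    simp only [h2] at h1
    rw [← h1, ← intervalIntegral.smul_integral_comp_mul_add, ← intervalIntegral.integral_smul]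
    exact intervalIntegral.integral_congr fun t _ => contIntegrand_affine hc e ρ v hψ t

/-- The squared norm contributes `|c|²` and the change of variables `|c|⁻¹`. -/
theorem energyOn_affine (hc : c ≠ 0) (a b e : ℝ) (v : ℝ → k.VecRKHS) :
    energyOn (fun t => c • v (c * t + e)) a b =
      ENNReal.ofReal |c| * energyOn v (c * a + e) (c * b + e) := by
  have he : MeasurableEmbedding fun t : ℝ => c * t + e :=
    ((Homeomorph.mulLeft₀ c hc).trans (Homeomorph.addRight e)).measurableEmbedding
  have h1 := he.lintegral_map (μ := volume.restrict (uIcc a b))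
    fun t => ENNReal.ofReal |c| ^ 2 * ‖v t‖ₑ ^ 2
  rw [map_affine_restrict hc, lintegral_smul_measure, smul_eq_mul,
    lintegral_const_mul' _ _ (by finiteness)] at h1
  rw [energyOn, energyOn]
  calc _ = ∫⁻ t in uIcc a b, ENNReal.ofReal |c| ^ 2 * ‖v (c * t + e)‖ₑ ^ 2 := by
        refine lintegral_congr fun t => ?_
        rw [enorm_smul, mul_pow, Real.enorm_eq_ofReal_abs]
    _ = _ := by
        rw [← h1, ← mul_assoc, ← ENNReal.ofReal_pow (abs_nonneg c),
          ← ENNReal.ofReal_mul (abs_nonneg _)]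
        congr 2
        rw [abs_inv]
        have := abs_pos.2 hc
        field_simp

/-- The oriented interval integral absorbs the reversal, so the field is unchanged; its sign flips
only when `IsFlow.affine` is applied with `c = -1`. -/
theorem IsFlow.symm (h : IsFlow μ ν ρ v a b) : IsFlow ν μ ρ v b a := by
  refine ⟨h.finish, h.start, by rw [uIcc_comm]; exact h.aemeasurable,
    by rw [uIcc_comm]; exact h.memLp, fun ψ hψ hc => ?_⟩
  rw [intervalIntegral.integral_symm, h.equation ψ hψ hc, neg_sub]

theorem IsFlow.trans (hab : a ≤ b) (hbc : b ≤ c) (h : IsFlow μ ν ρ v a b)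
    (h' : IsFlow ν κ ρ' v' b c) :
    IsFlow μ κ (fun t => if t ≤ b then ρ t else ρ' t) (fun t => if t ≤ b then v t else v' t)
      a c := by
  have hI : uIcc a c = Icc a b ∪ Ioc b c := by
    rw [uIcc_of_le (hab.trans hbc), Icc_union_Ioc_eq_Icc hab hbc]
  have e1 {X : Type _} (f g : ℝ → X) :
      (fun t => if t ≤ b then f t else g t) =ᵐ[volume.restrict (Icc a b)] f := by
    filter_upwards [ae_restrict_mem measurableSet_Icc] with t ht
    rw [if_pos ht.2]
  have e2 {X : Type _} (f g : ℝ → X) :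
      (fun t => if t ≤ b then f t else g t) =ᵐ[volume.restrict (Ioc b c)] g := by
    filter_upwards [ae_restrict_mem measurableSet_Ioc] with t ht
    rw [if_neg (not_le.2 ht.1)]
  have hle : volume.restrict (Ioc b c) ≤ volume.restrict (uIcc b c) := by
    rw [uIcc_of_le hbc]
    exact Measure.restrict_mono_set _ Ioc_subset_Icc_self
  have hρ : AEMeasurable (fun t => (if t ≤ b then ρ t else ρ' t).meas)
      (volume.restrict (uIcc a c)) := by
    rw [hI, aemeasurable_union_iff]
    constructor
    · have := h.aemeasurable
      rw [uIcc_of_le hab] at this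
      refine this.congr ?_
      filter_upwards [e1 ρ ρ'] with t ht using by rw [ht]
    · refine (h'.aemeasurable.mono_measure hle).congr ?_
      filter_upwards [e2 ρ ρ'] with t ht using by rw [ht]
  have hv : MemLp (fun t => if t ≤ b then v t else v' t) 2 (volume.restrict (uIcc a c)) := by
    have m1 : MemLp (fun t => if t ≤ b then v t else v' t) 2 (volume.restrict (Icc a b)) := by
      have := h.memLp
      rw [uIcc_of_le hab] at this
      exact this.ae_eq (e1 v v').symm
    have m2 : MemLp (fun t => if t ≤ b then v t else v' t) 2 (volume.restrict (Ioc b c)) :=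
      (h'.memLp.mono_measure hle).ae_eq (e2 v v').symm
    rw [memLp_two_iff] at m1 m2 ⊢
    rw [hI, aestronglyMeasurable_union_iff]
    refine ⟨⟨m1.1, m2.1⟩, (lintegral_union_le _ _ _).trans_lt (ENNReal.add_lt_top.2 ⟨m1.2, m2.2⟩)⟩
  refine ⟨by simp [hab, h.start], ?_, hρ, hv, fun ψ hψ hc => ?_⟩
  -- If `b = c`, the glued curve ends on the first branch, and the second flow, living on a single
  -- instant, forces `ν = κ`.
  · rcases hbc.eq_or_lt with rfl | hlt
    · simp [h.finish, ← h'.finish, h'.start]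
    · simp [not_le.2 hlt, h'.finish]
  · have : IsFiniteMeasure (volume.restrict (uIcc a c)) := by
      rw [uIcc_of_le (hab.trans hbc)]
      infer_instance
    have hint := integrable_contIntegrand hρ hv hψ hc
    have hii : IntervalIntegrable (contIntegrand (fun t => if t ≤ b then ρ t else ρ' t)
        (fun t => if t ≤ b then v t else v' t) ψ) volume a c := by
      rw [intervalIntegrable_iff]
      exact hint.mono_measure (Measure.restrict_mono_set _ uIoc_subset_uIcc)
    have hb : b ∈ uIcc a c := by rw [uIcc_of_le (hab.trans hbc)]; exact ⟨hab, hbc⟩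
    rw [← intervalIntegral.integral_add_adjacent_intervals
      (hii.mono_set (uIcc_subset_uIcc_left hb)) (hii.mono_set (uIcc_subset_uIcc_right hb))]
    have i1 : ∫ t in a..b, contIntegrand (fun t => if t ≤ b then ρ t else ρ' t)
        (fun t => if t ≤ b then v t else v' t) ψ t = ∫ t in a..b, contIntegrand ρ v ψ t := by
      refine intervalIntegral.integral_congr fun t ht => ?_
      rw [uIcc_of_le hab] at ht
      simp only [contIntegrand, if_pos ht.2]
    have i2 : ∫ t in b..c, contIntegrand (fun t => if t ≤ b then ρ t else ρ' t)
        (fun t => if t ≤ b then v t else v' t) ψ t = ∫ t in b..c, contIntegrand ρ' v' ψ t := by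
      refine intervalIntegral.integral_congr_ae (.of_forall fun t ht => ?_)
      rw [uIoc_of_le hbc] at ht
      simp only [contIntegrand, if_neg (not_le.2 ht.1)]
    rw [i1, i2, h.equation ψ hψ hc, h'.equation ψ hψ hc]
    ring

theorem energyOn_ite_le (hab : a ≤ b) (hbc : b ≤ c) (v v' : ℝ → k.VecRKHS) :
    energyOn (fun t => if t ≤ b then v t else v' t) a c ≤ energyOn v a b + energyOn v' b c := by
  rw [energyOn, energyOn, energyOn, uIcc_of_le hab, uIcc_of_le hbc, uIcc_of_le (hab.trans hbc),
    ← Icc_union_Ioc_eq_Icc hab hbc]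
  refine (lintegral_union_le _ _ _).trans (add_le_add (le_of_eq ?_) ?_)
  · exact setLIntegral_congr_fun measurableSet_Icc fun t ht => by simp [ht.2]
  · rw [setLIntegral_congr_fun (g := fun t => ‖v' t‖ₑ ^ 2) measurableSet_Ioc
      fun t ht => by simp [not_le.2 ht.1]]
    exact lintegral_mono_set Ioc_subset_Icc_self

end SteinGeometry

/-! ### Tangential projection, symmetry and the triangle inequality. -/

namespace SteinGeometry

variable {d : ℕ} {k : PDKernel d} {μ ν κ : Pk k} {ρ ρ' : ℝ → Pk k} {v v' : ℝ → k.VecRKHS}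

instance : IsFiniteMeasure (volume.restrict (uIcc (0 : ℝ) 1)) := by
  rw [uIcc_of_le zero_le_one]
  infer_instance

/-- The fields `v ∈ L²` with `v_t` tangent at `ρ_t` for almost every `t`. -/
noncomputable def tangentLp (k : PDKernel d) (m : Measure ℝ) (ρ : ℝ → Pk k) :
    Submodule ℝ (Lp k.VecRKHS 2 m) where
  carrier := {w | ∀ᵐ t ∂m, w t ∈ (gradSubmodule k (ρ t)).topologicalClosure}
  zero_mem' := by
    filter_upwards [Lp.coeFn_zero k.VecRKHS 2 m] with t ht
    rw [ht]
    exact Submodule.zero_mem _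
  add_mem' := by
    intro f g hf hg
    filter_upwards [hf, hg, Lp.coeFn_add f g] with t h1 h2 h3
    rw [h3]
    exact Submodule.add_mem _ h1 h2
  smul_mem' := by
    intro c f hf
    filter_upwards [hf, Lp.coeFn_smul c f] with t h1 h3
    rw [h3]
    exact Submodule.smul_mem _ _ h1

theorem mem_tangentLp {m : Measure ℝ} {w : Lp k.VecRKHS 2 m} :
    w ∈ tangentLp k m ρ ↔ ∀ᵐ t ∂m, w t ∈ tangentFields k (ρ t) := Iff.rfl

/-- An `L²`-convergent sequence has a subsequence converging almost everywhere, along which the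
pointwise closed constraint passes to the limit. -/
theorem isClosed_tangentLp (k : PDKernel d) (m : Measure ℝ) (ρ : ℝ → Pk k) :
    IsClosed (tangentLp k m ρ : Set (Lp k.VecRKHS 2 m)) := by
  rw [← isSeqClosed_iff_isClosed]
  intro f g hf hfg
  obtain ⟨ns, -, hns⟩ := (tendstoInMeasure_of_tendsto_Lp hfg).exists_seq_tendsto_ae
  have h1 : ∀ᵐ t ∂m, ∀ n, f n t ∈ (gradSubmodule k (ρ t)).topologicalClosure :=
    ae_all_iff.2 hf
  change ∀ᵐ t ∂m, g t ∈ (gradSubmodule k (ρ t)).topologicalClosure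
  filter_upwards [h1, hns] with t ht1 ht2
  exact (Submodule.isClosed_topologicalClosure _).mem_of_tendsto ht2
    (.of_forall fun n => ht1 (ns n))

/-- Replacing a field by its tangential part does not change the continuity equation and does not
increase the energy. -/
theorem IsFlow.exists_tangent (h : IsFlow μ ν ρ v 0 1) :
    ∃ w, IsFlow μ ν ρ w 0 1 ∧ energy w ≤ energy v ∧ ∀ t, w t ∈ tangentFields k (ρ t) := by
  classical
  set m := volume.restrict (uIcc (0 : ℝ) 1) with hm
  let S := tangentLp k m ρ
  have : CompleteSpace S := (isClosed_tangentLp k m ρ).completeSpace_coe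
  let V : Lp k.VecRKHS 2 m := h.memLp.toLp v
  -- A single projection in `L²`, instead of one at each time, makes measurability of the projected
  -- field automatic.
  let P : Lp k.VecRKHS 2 m := S.starProjection V
  have hP : P ∈ S := Submodule.starProjection_apply_mem _ _
  have hle : ‖P‖ ≤ ‖V‖ := Submodule.norm_starProjection_apply_le _ _
  -- Tangency is required at every time, so the field is set to zero on the exceptional null set.
  let w : ℝ → k.VecRKHS := fun t => if P t ∈ tangentFields k (ρ t) then P t else 0
  have hwP : w =ᵐ[m] P := by
    filter_upwards [mem_tangentLp.1 hP] with t ht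
    simp [w, ht]
  have hw : MemLp w 2 m := (Lp.memLp P).ae_eq hwP.symm
  refine ⟨w, ⟨h.start, h.finish, h.aemeasurable, hw, fun ψ hψ hc => ?_⟩, ?_, fun t => ?_⟩
  · rw [← h.equation ψ hψ hc]
    have hG := memLp_gradCurve h.aemeasurable hψ hc
    have hGS : hG.toLp _ ∈ S := by
      refine mem_tangentLp.2 ?_
      filter_upwards [hG.coeFn_toLp] with t ht
      rw [ht]
      exact subset_closure (gradCurve_mem ρ hψ hc t)
    -- The curve `T_{k,ρ_t}∇ψ` is itself tangent, hence orthogonal to the discarded part of the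
    -- field.
    have horth : inner ℝ (hG.toLp _) (V - P) = 0 :=
      (Submodule.mem_orthogonal _ _).1 (Submodule.sub_starProjection_mem_orthogonal V) _ hGS
    rw [L2.inner_def] at horth
    have hzero : ∫ t, (inner ℝ (gradCurve ρ ψ t) (v t) - inner ℝ (gradCurve ρ ψ t) (w t)) ∂m
        = 0 := by
      rw [← horth]
      refine integral_congr_ae ?_
      filter_upwards [hG.coeFn_toLp, Lp.coeFn_sub V P, h.memLp.coeFn_toLp, hwP] with t h1 h2 h3 h4
      rw [h1, h2, h4, Pi.sub_apply, h3, inner_sub_right]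
    rw [integral_sub (integrable_inner_gradCurve h.aemeasurable h.memLp hψ hc)
      (integrable_inner_gradCurve h.aemeasurable hw hψ hc), sub_eq_zero] at hzero
    have key (u : ℝ → k.VecRKHS) (hu : MemLp u 2 m) : ∫ t in (0 : ℝ)..1, contIntegrand ρ u ψ t =
        (∫ t, ∫ x, deriv (fun s => ψ (s, x)) t ∂(ρ t).meas ∂m) +
          ∫ t, inner ℝ (gradCurve ρ ψ t) (u t) ∂m := by
      rw [intervalIntegral.integral_of_le zero_le_one, ← integral_Icc_eq_integral_Ioc,
        ← uIcc_of_le zero_le_one, ← hm, ← integral_add (integrable_deriv_slice h.aemeasurable hψ hc)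
        (integrable_inner_gradCurve h.aemeasurable hu hψ hc)]
      simp_rw [contIntegrand_eq ρ u hψ hc]
      rfl
    rw [key w hw, key v h.memLp, hzero]
  · have e (u : ℝ → k.VecRKHS) : energy u = eLpNorm u 2 m ^ 2 := by
      rw [eLpNorm_eq_lintegral_rpow_enorm_toReal (by simp) (by simp), ← energyOn_zero_one, energyOn,
        ← ENNReal.rpow_natCast, ← ENNReal.rpow_mul]
      simp [hm]
    rw [e, e, eLpNorm_congr_ae hwP]
    gcongr
    have h2 : eLpNorm v 2 m = ‖V‖ₑ := by rw [Lp.enorm_toLp]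
    rw [h2, ← Lp.enorm_def, enorm_le_iff_norm_le]
    exact hle
  · by_cases ht : P t ∈ tangentFields k (ρ t)
    · simp [w, ht]
    · simp only [w, if_neg ht]
      exact Submodule.zero_mem (gradSubmodule k (ρ t)).topologicalClosure

theorem steinDist_sq (k : PDKernel d) (μ ν : Pk k) :
    steinDist k μ ν ^ 2 =
      ⨅ (ρ : ℝ → Pk k) (v : ℝ → k.VecRKHS) (_ : IsConnecting μ ν ρ v), energy v := by
  rw [steinDist, ← ENNReal.rpow_natCast, ← ENNReal.rpow_mul]
  norm_num
  refine le_antisymm ?_ ?_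
  · refine le_iInf₂ fun ρ v => le_iInf fun h => ?_
    rcases eq_or_ne (energy v) ⊤ with htop | htop
    · simp [htop]
    obtain ⟨w, hw, hle, ht⟩ := (isFlow_iff.2 ⟨h, htop.lt_top⟩).exists_tangent
    exact (iInf₂_le_of_le ρ w <| iInf₂_le_of_le (isFlow_iff.1 hw).1 (fun t _ _ => ht t) le_rfl).trans
      hle
  · refine le_iInf₂ fun ρ v => le_iInf₂ fun h _ => ?_
    exact iInf₂_le_of_le ρ v <| iInf_le_of_le h le_rfl

theorem steinDist_le (h : IsFlow μ ν ρ v 0 1) {a : ENNReal} (ha : energy v ≤ a ^ 2) :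
    steinDist k μ ν ≤ a := by
  refine (ENNReal.pow_right_strictMono two_ne_zero).le_iff_le.1 (le_trans ?_ ha)
  rw [steinDist_sq]
  exact iInf₂_le_of_le ρ v <| iInf_le_of_le (isFlow_iff.1 h).1 le_rfl

theorem exists_isFlow_of_steinDist_lt {a : ENNReal} (ha : steinDist k μ ν < a) :
    ∃ ρ v, IsFlow μ ν ρ v 0 1 ∧ energy v < a ^ 2 := by
  have h := ENNReal.pow_right_strictMono two_ne_zero ha
  simp only [steinDist_sq, iInf_lt_iff] at h
  obtain ⟨ρ, v, hc, he⟩ := h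
  exact ⟨ρ, v, isFlow_iff.2 ⟨hc, he.trans_le le_top⟩, he⟩

theorem steinDist_symm_le (k : PDKernel d) (μ ν : Pk k) : steinDist k ν μ ≤ steinDist k μ ν := by
  refine le_of_forall_gt_imp_ge_of_dense fun a ha => ?_
  obtain ⟨ρ, v, h, he⟩ := exists_isFlow_of_steinDist_lt ha
  -- The end points are written for the substitution `t ↦ 1 - t`.
  have h1 : IsFlow ν μ ρ v (-1 * 0 + 1) (-1 * 1 + 1) := by
    simpa using h.symm
  refine steinDist_le (h1.affine (by norm_num)) (le_trans (le_of_eq ?_) he.le)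
  rw [← energyOn_zero_one, energyOn_affine (by norm_num), ← energyOn_zero_one]
  simp [energyOn]

theorem steinDist_comm (k : PDKernel d) (μ ν : Pk k) : steinDist k μ ν = steinDist k ν μ :=
  le_antisymm (steinDist_symm_le k ν μ) (steinDist_symm_le k μ ν)

theorem steinDist_le_add {a b : ℝ} (ha : 0 < a) (hb : 0 < b)
    (h1 : steinDist k μ ν < ENNReal.ofReal a) (h2 : steinDist k ν κ < ENNReal.ofReal b) :
    steinDist k μ κ ≤ ENNReal.ofReal (a + b) := by
  obtain ⟨ρ, v, h, he⟩ := exists_isFlow_of_steinDist_lt h1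
  obtain ⟨ρ', v', h', he'⟩ := exists_isFlow_of_steinDist_lt h2
  have hab : 0 < a + b := by positivity
  -- Time shares proportional to `a` and `b` give constant-speed weights: the energies add up to at
  -- most `a²(a+b)/a + b²(a+b)/b = (a+b)²`.
  set l := a / (a + b) with hl
  have hl0 : 0 < l := by positivity
  have hl1 : l < 1 := by rw [hl, div_lt_one hab]; linarith
  have hc1 : (a + b) / a ≠ 0 := by positivity
  have hc2 : (a + b) / b ≠ 0 := by positivity
  have e1 : (a + b) / a * 0 + 0 = 0 := by ring
  have e2 : (a + b) / a * l + 0 = 1 := by rw [hl]; field_simp; simp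
  have e3 : (a + b) / b * l + -(a / b) = 0 := by rw [hl]; field_simp; ring
  have e4 : (a + b) / b * 1 + -(a / b) = 1 := by field_simp; ring
  have f1 := IsFlow.affine (a := 0) (b := l) (e := 0) hc1 (by rw [e1, e2]; exact h)
  have f2 := IsFlow.affine (a := l) (b := 1) (e := -(a / b)) hc2 (by rw [e3, e4]; exact h')
  refine steinDist_le (f1.trans hl0.le hl1.le f2) ?_
  rw [← energyOn_zero_one]
  refine (energyOn_ite_le hl0.le hl1.le _ _).trans ?_
  rw [energyOn_affine hc1, energyOn_affine hc2, e1, e2, e3, e4, energyOn_zero_one,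
    energyOn_zero_one]
  calc _ ≤ ENNReal.ofReal |(a + b) / a| * ENNReal.ofReal a ^ 2 +
        ENNReal.ofReal |(a + b) / b| * ENNReal.ofReal b ^ 2 := by gcongr
    _ = ENNReal.ofReal (a + b) ^ 2 := by
      rw [abs_of_pos (by positivity), abs_of_pos (by positivity), ← ENNReal.ofReal_pow ha.le,
        ← ENNReal.ofReal_pow hb.le, ← ENNReal.ofReal_pow hab.le,
        ← ENNReal.ofReal_mul (by positivity), ← ENNReal.ofReal_mul (by positivity),
        ← ENNReal.ofReal_add (by positivity) (by positivity)]
      congr 1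
      field_simp

theorem steinDist_triangle (k : PDKernel d) (μ ν κ : Pk k) :
    steinDist k μ κ ≤ steinDist k μ ν + steinDist k ν κ := by
  refine ENNReal.le_of_forall_pos_le_add fun ε hε hfin => ?_
  obtain ⟨h1, h2⟩ := ENNReal.add_lt_top.1 hfin
  have hε' : (0 : ℝ) < ε / 2 := by positivity
  have key (x : ENNReal) (hx : x < ⊤) : x < ENNReal.ofReal (x.toReal + ε / 2) := by
    rw [ENNReal.lt_ofReal_iff_toReal_lt hx.ne]
    linarith
  refine (steinDist_le_add (by positivity) (by positivity) (key _ h1) (key _ h2)).trans ?_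
  rw [show (steinDist k μ ν).toReal + ε / 2 + ((steinDist k ν κ).toReal + ε / 2) =
    (steinDist k μ ν).toReal + (steinDist k ν κ).toReal + ε by ring,
    ENNReal.ofReal_add (by positivity) (by positivity),
    ENNReal.ofReal_add (by positivity) (by positivity), ENNReal.ofReal_toReal h1.ne,
    ENNReal.ofReal_toReal h2.ne, ENNReal.ofReal_coe_nnreal]

end SteinGeometry

/-! ### Test functions compactly supported in space only; separation of points. -/

namespace SteinGeometry

variable {d : ℕ} {k : PDKernel d} {μ ν κ : Pk k} {ρ ρ' : ℝ → Pk k} {v v' : ℝ → k.VecRKHS}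

/-- A smooth cutoff in time, equal to one near `[0,1]`. -/
noncomputable def timeCutoff : ContDiffBump (1 / 2 : ℝ) := ⟨1, 2, one_pos, one_lt_two⟩

theorem timeCutoff_eventually_eq_one {t : ℝ} (ht : t ∈ Icc (0 : ℝ) 1) :
    timeCutoff =ᶠ[nhds t] 1 := by
  refine timeCutoff.eventuallyEq_one_of_mem_ball ?_
  rw [Metric.mem_ball, Real.dist_eq, abs_lt]
  change -1 < _ ∧ _ < (1 : ℝ)
  constructor <;> linarith [ht.1, ht.2]

theorem timeCutoff_eq_one {t : ℝ} (ht : t ∈ Icc (0 : ℝ) 1) : timeCutoff t = 1 :=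
  (timeCutoff_eventually_eq_one ht).eq_of_nhds

/-- The bump has centre `1/2` and outer radius `2`, so its support lies in `[-3/2, 5/2]`; `[-2, 3]`
is a convenient larger interval. -/
theorem timeCutoff_eq_zero {t : ℝ} (ht : t ∉ Icc (-2 : ℝ) 3) : timeCutoff t = 0 := by
  refine timeCutoff.zero_of_le_dist ?_
  rw [Real.dist_eq]
  change (2 : ℝ) ≤ _
  contrapose! ht
  rw [abs_lt] at ht
  constructor <;> linarith [ht.1, ht.2]

theorem contDiff_cutoff_mul {u : ℝ × Euc d → ℝ} (hu : ContDiff ℝ ∞ u) :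
    ContDiff ℝ ∞ fun p : ℝ × Euc d => timeCutoff p.1 * u p :=
  (timeCutoff.contDiff.comp contDiff_fst).mul hu

theorem hasCompactSupport_cutoff_mul {u : ℝ × Euc d → ℝ} {K : Set (Euc d)}
    (hK : IsCompact K) (hz : ∀ t ∈ Icc (-2 : ℝ) 3, ∀ x ∉ K, u (t, x) = 0) :
    HasCompactSupport fun p : ℝ × Euc d => timeCutoff p.1 * u p := by
  refine HasCompactSupport.intro (isCompact_Icc.prod hK : IsCompact (Icc (-2 : ℝ) 3 ×ˢ K)) ?_
  rintro ⟨t, x⟩ hp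
  by_cases ht : t ∈ Icc (-2 : ℝ) 3
  · simp [hz t ht x fun hx => hp ⟨ht, hx⟩]
  · simp [timeCutoff_eq_zero ht]

theorem contIntegrand_cutoff_mul (ρ : ℝ → Pk k) (v : ℝ → k.VecRKHS) (u : ℝ × Euc d → ℝ) {t : ℝ}
    (ht : t ∈ Icc (0 : ℝ) 1) :
    contIntegrand ρ v (fun p : ℝ × Euc d => timeCutoff p.1 * u p) t = contIntegrand ρ v u t := by
  have h1 (x : Euc d) : deriv (fun s => timeCutoff s * u (s, x)) t =
      deriv (fun s => u (s, x)) t := by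
    refine Filter.EventuallyEq.deriv_eq ?_
    filter_upwards [timeCutoff_eventually_eq_one ht] with s hs
    rw [hs, Pi.one_apply, one_mul]
  simp only [contIntegrand, h1, timeCutoff_eq_one ht, one_mul]

/-- The continuity equation holds for test functions that are compactly supported in space. -/
theorem IsFlow.equation_of_isCompact (h : IsFlow μ ν ρ v 0 1) {u : ℝ × Euc d → ℝ}
    (hu : ContDiff ℝ ∞ u) {K : Set (Euc d)} (hK : IsCompact K)
    (hz : ∀ t ∈ Icc (-2 : ℝ) 3, ∀ x ∉ K, u (t, x) = 0) :
    IntervalIntegrable (contIntegrand ρ v u) volume 0 1 ∧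
      ∫ t in (0 : ℝ)..1, contIntegrand ρ v u t =
        (∫ x, u (1, x) ∂ν.meas) - ∫ x, u (0, x) ∂μ.meas := by
  have h1 := contDiff_cutoff_mul hu
  have h2 := hasCompactSupport_cutoff_mul hK hz
  have h3 := integrable_contIntegrand h.aemeasurable h.memLp h1 h2
  have h4 : ∀ t ∈ uIcc (0 : ℝ) 1,
      contIntegrand ρ v (fun p : ℝ × Euc d => timeCutoff p.1 * u p) t = contIntegrand ρ v u t :=
    fun t ht => contIntegrand_cutoff_mul ρ v u (by rwa [uIcc_of_le zero_le_one] at ht)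
  constructor
  · rw [intervalIntegrable_iff]
    refine (h3.mono_measure (Measure.restrict_mono_set _ uIoc_subset_uIcc)).congr ?_
    filter_upwards [ae_restrict_mem measurableSet_uIoc] with t ht
    exact h4 t (uIoc_subset_uIcc ht)
  · rw [← intervalIntegral.integral_congr h4, h.equation _ h1 h2]
    simp only [timeCutoff_eq_one (show (0 : ℝ) ∈ Icc (0 : ℝ) 1 by simp),
      timeCutoff_eq_one (show (1 : ℝ) ∈ Icc (0 : ℝ) 1 by simp), one_mul]

theorem isFlow_const (μ : Pk k) : IsFlow μ μ (fun _ => μ) (fun _ => 0) 0 1 := by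
  refine ⟨rfl, rfl, aemeasurable_const, MemLp.zero, fun ψ hψ hc => ?_⟩
  have hd := continuous_deriv_slice hψ
  have hdc := hasCompactSupport_deriv_slice hψ hc
  simp only [contIntegrand, show ∀ x, vecField (0 : k.VecRKHS) x = 0 from fun x => by
    ext i; simp [vecField], inner_zero_right, integral_zero, add_zero]
  rw [intervalIntegral_integral_swap]
  · rw [← integral_sub]
    · refine integral_congr_ae (.of_forall fun x => ?_)
      have hs : ContDiff ℝ ∞ fun s => ψ (s, x) := hψ.comp (contDiff_id.prodMk contDiff_const)
      refine intervalIntegral.integral_deriv_eq_sub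
        (fun t _ => hs.differentiable (by simp) t) ?_
      exact (hs.continuous_deriv (by simp)).intervalIntegrable _ _
    · exact (contDiff_slice hψ 1).continuous.integrable_of_hasCompactSupport (hc.slice 1)
    · exact (contDiff_slice hψ 0).continuous.integrable_of_hasCompactSupport (hc.slice 0)
  · have : IsFiniteMeasure (volume.restrict (uIoc (0 : ℝ) 1)) := by
      rw [uIoc_of_le zero_le_one]; infer_instance
    exact hd.integrable_of_hasCompactSupport hdc

theorem steinDist_self (μ : Pk k) : steinDist k μ μ = 0 :=
  le_antisymm (steinDist_le (isFlow_const μ) (by simp [energy])) zero_le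

theorem integral_norm_le_of_energy_le (hv : MemLp v 2 (volume.restrict (uIcc (0 : ℝ) 1))) {a : ℝ}
    (ha : 0 ≤ a) (h : energy v ≤ ENNReal.ofReal a ^ 2) :
    ∫ t in (0 : ℝ)..1, ‖v t‖ ≤ a := by
  -- Since `[0,1]` has mass one, the `L¹` norm is at most the `L²` norm.
  have : IsProbabilityMeasure (volume.restrict (uIcc (0 : ℝ) 1)) := ⟨by simp⟩
  have h1 := eLpNorm_le_eLpNorm_of_exponent_le (p := 1) (q := 2) (by norm_num) hv.1
  rw [eLpNorm_one_eq_lintegral_enorm] at h1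
  have h2 : eLpNorm v 2 (volume.restrict (uIcc (0 : ℝ) 1)) ≤ ENNReal.ofReal a := by
    refine (ENNReal.pow_right_strictMono two_ne_zero).le_iff_le.1 (le_trans (le_of_eq ?_) h)
    rw [eLpNorm_eq_lintegral_rpow_enorm_toReal (by simp) (by simp), ← energyOn_zero_one, energyOn,
      ← ENNReal.rpow_natCast, ← ENNReal.rpow_mul]
    simp
  rw [intervalIntegral.integral_of_le zero_le_one, ← integral_Icc_eq_integral_Ioc,
    ← uIcc_of_le zero_le_one, integral_norm_eq_lintegral_enorm hv.1]
  exact ENNReal.toReal_le_of_le_ofReal ha (h1.trans h2)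

/-- For a time-independent test function the time derivative drops out on `[0,1]`, leaving at most
`|C| ∫ ‖v_t‖ dt` with `C` independent of the curve; the energy can be taken arbitrarily small. -/
theorem integral_eq_of_steinDist_eq_zero (h : steinDist k μ ν = 0) {φ : Euc d → ℝ}
    (hφ : ContDiff ℝ ∞ φ) (hc : HasCompactSupport φ) :
    ∫ x, φ x ∂μ.meas = ∫ x, φ x ∂ν.meas := by
  have hu : ContDiff ℝ ∞ fun p : ℝ × Euc d => φ p.2 := hφ.comp contDiff_snd
  have hz : ∀ t ∈ Icc (-2 : ℝ) 3, ∀ x ∉ tsupport φ, (fun p : ℝ × Euc d => φ p.2) (t, x) = 0 :=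
    fun t _ x hx => image_eq_zero_of_notMem_tsupport hx
  have h1 := contDiff_cutoff_mul hu
  have h2 := hasCompactSupport_cutoff_mul (u := fun p : ℝ × Euc d => φ p.2) hc.isCompact hz
  obtain ⟨C, hC⟩ := exists_norm_gradCurve_le k h1 h2
  have key : ∀ a : ℝ, 0 < a → |(∫ x, φ x ∂ν.meas) - ∫ x, φ x ∂μ.meas| ≤ |C| * a := by
    intro a ha
    obtain ⟨ρ, v, hf, he⟩ := exists_isFlow_of_steinDist_lt (a := ENNReal.ofReal a)
      (by rw [h]; exact ENNReal.ofReal_pos.2 ha)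
    rw [← (hf.equation_of_isCompact hu hc.isCompact hz).2, ← Real.norm_eq_abs]
    have hvi : IntervalIntegrable (fun t => ‖v t‖) volume 0 1 := by
      rw [intervalIntegrable_iff]
      exact ((hf.memLp.integrable (by norm_num)).mono_measure
        (Measure.restrict_mono_set _ uIoc_subset_uIcc)).norm
    calc ‖∫ t in (0 : ℝ)..1, contIntegrand ρ v (fun p : ℝ × Euc d => φ p.2) t‖
        ≤ ∫ t in (0 : ℝ)..1, |C| * ‖v t‖ := by
          refine intervalIntegral.norm_integral_le_of_norm_le zero_le_one
            (.of_forall fun t ht => ?_) (hvi.const_mul _)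
          have ht' : t ∈ Icc (0 : ℝ) 1 := Ioc_subset_Icc_self ht
          have hd (x : Euc d) : deriv (fun s => timeCutoff s * φ x) t = 0 := by
            rw [Filter.EventuallyEq.deriv_eq (f := fun _ => φ x), deriv_const]
            filter_upwards [timeCutoff_eventually_eq_one ht'] with s hs
            rw [hs, Pi.one_apply, one_mul]
          rw [← contIntegrand_cutoff_mul ρ v _ ht', contIntegrand_eq ρ v h1 h2]
          simp only [hd, integral_zero, zero_add]
          exact (norm_inner_le_norm _ _).trans (mul_le_mul_of_nonneg_right
            ((hC ρ t).trans (le_abs_self C)) (norm_nonneg _))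
      _ ≤ |C| * a := by
          rw [intervalIntegral.integral_const_mul]
          exact mul_le_mul_of_nonneg_left
            (integral_norm_le_of_energy_le hf.memLp ha.le he.le) (abs_nonneg C)
  have h0 : |(∫ x, φ x ∂ν.meas) - ∫ x, φ x ∂μ.meas| ≤ 0 := by
    refine le_of_forall_pos_le_add fun ε hε => (key (ε / (|C| + 1)) (by positivity)).trans ?_
    rw [zero_add, ← mul_div_assoc, div_le_iff₀ (by positivity)]
    nlinarith [abs_nonneg C]
  exact (sub_eq_zero.1 (abs_nonpos_iff.1 h0)).symm

theorem Pk.ext_of_integral (h : ∀ φ : Euc d → ℝ, ContDiff ℝ ∞ φ → HasCompactSupport φ →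
    ∫ x, φ x ∂μ.meas = ∫ x, φ x ∂ν.meas) : μ = ν := by
  obtain ⟨⟨f, hf, hf0, hμ⟩, -⟩ := μ.2
  obtain ⟨⟨g, hg, hg0, hν⟩, -⟩ := ν.2
  refine Subtype.ext (Subtype.ext ?_)
  change (μ.1 : Measure (Euc d)) = (ν.1 : Measure (Euc d))
  have key (f : Euc d → ℝ) (hf : ContDiff ℝ ∞ f) (hf0 : ∀ x, 0 ≤ f x) (φ : Euc d → ℝ) :
      ∫ x, φ x ∂(volume.withDensity fun x => ENNReal.ofReal (f x)) = ∫ x, φ x • f x := by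
    rw [integral_withDensity_eq_integral_toReal_smul
      hf.continuous.measurable.ennreal_ofReal (.of_forall fun x => ENNReal.ofReal_lt_top)]
    refine integral_congr_ae (.of_forall fun x => ?_)
    simp only [ENNReal.toReal_ofReal (hf0 x), smul_eq_mul, mul_comm]
  have := ae_eq_of_integral_contDiff_smul_eq hf.continuous.locallyIntegrable
    hg.continuous.locallyIntegrable (μ := volume) fun φ h1 h2 => by
      rw [← key f hf hf0, ← key g hg hg0, ← hμ, ← hν]
      exact h φ h1 h2
  rw [hμ, hν]
  refine withDensity_congr_ae ?_
  filter_upwards [this] with x hx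
  rw [hx]

theorem steinDist_eq_zero_iff : steinDist k μ ν = 0 ↔ μ = ν :=
  ⟨fun h => Pk.ext_of_integral fun _ h1 h2 => integral_eq_of_steinDist_eq_zero h h1 h2,
    fun h => h ▸ steinDist_self μ⟩

end SteinGeometry

/-! ### Finite propagation speed for bounded kernels. -/

namespace SteinGeometry

variable {d : ℕ} {k : PDKernel d} {μ ν κ : Pk k} {ρ ρ' : ℝ → Pk k} {v v' : ℝ → k.VecRKHS}

/-- Mollification: averaging translates with a weight of mass one preserves the Lipschitz constant
and moves values by at most the radius `ε`. -/
theorem exists_contDiff_lipschitz_near {f : Euc d → ℝ} (hf : LipschitzWith 1 f) {ε : ℝ}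
    (hε : 0 < ε) :
    ∃ D : Euc d → ℝ, ContDiff ℝ ∞ D ∧ LipschitzWith 1 D ∧ ∀ x, |D x - f x| ≤ ε := by
  let φ : ContDiffBump (0 : Euc d) := ⟨ε / 2, ε, half_pos hε, half_lt_self hε⟩
  have hdef (x : Euc d) : convolution (φ.normed volume) f (ContinuousLinearMap.lsmul ℝ ℝ)
      volume x = ∫ t, φ.normed volume t * f (x - t) := rfl
  have hint (x : Euc d) : Integrable fun t => φ.normed volume t * f (x - t) := by
    refine Continuous.integrable_of_hasCompactSupport ?_ φ.hasCompactSupport_normed.mul_right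
    exact φ.continuous_normed.mul (hf.continuous.comp (continuous_const.sub continuous_id))
  refine ⟨convolution (φ.normed volume) f (ContinuousLinearMap.lsmul ℝ ℝ) volume, ?_, ?_, ?_⟩
  · exact φ.hasCompactSupport_normed.contDiff_convolution_left _ φ.contDiff_normed
      hf.continuous.locallyIntegrable
  · refine LipschitzWith.of_dist_le_mul fun x y => ?_
    rw [hdef, hdef, Real.dist_eq, ← integral_sub (hint x) (hint y), NNReal.coe_one, one_mul]
    calc |∫ t, (φ.normed volume t * f (x - t) - φ.normed volume t * f (y - t))|
        ≤ ∫ t, φ.normed volume t * dist x y := by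
          rw [← Real.norm_eq_abs]
          refine norm_integral_le_of_norm_le (φ.integrable_normed.mul_const _)
            (.of_forall fun t => ?_)
          rw [← mul_sub, norm_mul, Real.norm_of_nonneg (φ.nonneg_normed t)]
          refine mul_le_mul_of_nonneg_left ?_ (φ.nonneg_normed t)
          rw [← dist_eq_norm]
          refine (hf.dist_le_mul _ _).trans (le_of_eq ?_)
          simp
      _ = dist x y := by rw [integral_mul_const, φ.integral_normed, one_mul]
  · intro x
    rw [← Real.dist_eq]
    refine φ.dist_normed_convolution_le hf.continuous.aestronglyMeasurable fun y hy => ?_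
    refine (hf.dist_le_mul y x).trans ?_
    rw [NNReal.coe_one, one_mul]
    exact (Metric.mem_ball.1 hy).le

/-- Approximation in `L¹` by a continuous function, then uniformly by a polynomial, whose primitive
is `l`. It provides a smooth front position when the speed is merely integrable. -/
theorem exists_contDiff_deriv_near {f : ℝ → ℝ} (hf : IntervalIntegrable f volume 0 1) {η : ℝ}
    (hη : 0 < η) :
    ∃ l : ℝ → ℝ, ContDiff ℝ ∞ l ∧ l 0 = 0 ∧ ∫ t in (0 : ℝ)..1, |deriv l t - f t| ≤ η := by
  have hf' : IntegrableOn f (Ioc 0 1) := (intervalIntegrable_iff_integrableOn_Ioc_of_le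
    zero_le_one).1 hf
  obtain ⟨g, -, hg, hgc, -⟩ := hf'.exists_hasCompactSupport_integral_sub_le (half_pos hη)
  obtain ⟨p, hp⟩ := exists_polynomial_near_of_continuousOn 0 1 g hgc.continuousOn _ (half_pos hη)
  have hpc : Continuous fun x => p.eval x := p.continuous
  have hderiv : deriv (fun t => ∫ s in (0 : ℝ)..t, p.eval s) = fun x => p.eval x :=
    funext fun t => Continuous.deriv_integral _ hpc 0 t
  refine ⟨fun t => ∫ s in (0 : ℝ)..t, p.eval s, ?_, by simp, ?_⟩
  · rw [contDiff_infty_iff_deriv, hderiv]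
    refine ⟨fun t => ?_, by simpa using p.contDiff_aeval (𝕜 := ℝ) ∞⟩
    exact (hpc.integral_hasStrictDerivAt 0 t).hasDerivAt.differentiableAt
  · rw [hderiv]
    have hgi : IntervalIntegrable g volume 0 1 := hgc.intervalIntegrable _ _
    calc ∫ t in (0 : ℝ)..1, |p.eval t - f t|
        ≤ ∫ t in (0 : ℝ)..1, (η / 2 + ‖f t - g t‖) := by
          refine intervalIntegral.integral_mono_on zero_le_one
            ((hpc.intervalIntegrable _ _).sub hf).abs
            (intervalIntegrable_const.add (hf.sub hgi).norm) fun t ht => ?_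
          have := hp t ht
          rw [Real.norm_eq_abs, abs_sub_comm (f t)]
          calc |p.eval t - f t| = |(p.eval t - g t) + (g t - f t)| := by ring_nf
            _ ≤ |p.eval t - g t| + |g t - f t| := abs_add_le _ _
            _ ≤ _ := by linarith
      _ ≤ η := by
          rw [intervalIntegral.integral_add intervalIntegrable_const (hf.sub hgi).norm,
            intervalIntegral.integral_const, intervalIntegral.integral_of_le zero_le_one]
          simp only [sub_zero, one_smul]
          linarith

/-- A smooth nonincreasing cutoff between `c₁` and `c₂`, with bounded derivative. -/
theorem exists_smooth_step {c₁ c₂ : ℝ} (h : c₁ < c₂) :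
    ∃ g : ℝ → ℝ, ContDiff ℝ ∞ g ∧ Antitone g ∧ (∀ s, 0 ≤ g s) ∧ (∀ s, g s ≤ 1) ∧
      (∀ s ≤ c₁, g s = 1) ∧ (∀ s, c₂ ≤ s → g s = 0) ∧ ∃ G, ∀ s, |deriv g s| ≤ G := by
  have hc : 0 < c₂ - c₁ := sub_pos.2 h
  let g : ℝ → ℝ := fun s => Real.smoothTransition ((c₂ - s) / (c₂ - c₁))
  have hg : ContDiff ℝ ∞ g :=
    Real.smoothTransition.contDiff.comp ((contDiff_const.sub contDiff_id).div_const _)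
  have h1 : ∀ s ≤ c₁, g s = 1 := fun s hs =>
    Real.smoothTransition.one_of_one_le (by rw [le_div_iff₀ hc]; linarith)
  have h0 : ∀ s, c₂ ≤ s → g s = 0 := fun s hs =>
    Real.smoothTransition.zero_of_nonpos (div_nonpos_of_nonpos_of_nonneg (by linarith) hc.le)
  refine ⟨g, hg, fun s t hst => Real.smoothTransition.monotone (by gcongr),
    fun s => Real.smoothTransition.nonneg _, fun s => Real.smoothTransition.le_one _, h1, h0, ?_⟩
  have hcs : HasCompactSupport (deriv g) := by
    refine HasCompactSupport.intro (isCompact_Icc (a := c₁) (b := c₂)) fun s hs => ?_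
    rw [mem_Icc, not_and_or, not_le, not_le] at hs
    rcases hs with hs | hs
    · rw [Filter.EventuallyEq.deriv_eq (f := fun _ => (1 : ℝ)), deriv_const]
      filter_upwards [Iio_mem_nhds hs] with t ht using h1 t (le_of_lt ht)
    · rw [Filter.EventuallyEq.deriv_eq (f := fun _ => (0 : ℝ)), deriv_const]
      filter_upwards [Ioi_mem_nhds hs] with t ht using h0 t (le_of_lt ht)
  obtain ⟨G, hG⟩ := (hg.continuous_deriv (by simp)).bounded_above_of_compact_support hcs
  exact ⟨G, hG⟩

theorem norm_vecField_le_of_bounded {B : ℝ} (hB : ∀ x y, |k x y| ≤ B) (u : k.VecRKHS) (x : Euc d) :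
    ‖vecField u x‖ ≤ √B * ‖u‖ :=
  (norm_vecField_le u x).trans (mul_le_mul_of_nonneg_right
    (Real.sqrt_le_sqrt ((le_abs_self _).trans (hB x x))) (norm_nonneg _))

/-- The integrand of the continuity equation for a moving front `g(D(x) - l(t))` is almost
nonnegative when the front moves at least as fast as the field. -/
theorem contIntegrand_front_ge {B : ℝ} (hB : ∀ x y, |k x y| ≤ B) {g l : ℝ → ℝ} {D : Euc d → ℝ}
    (hg : ContDiff ℝ ∞ g) (hga : Antitone g) {G : ℝ} (hG : ∀ s, |deriv g s| ≤ G)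
    (hl : ContDiff ℝ ∞ l) (hD : ContDiff ℝ ∞ D) (hDl : LipschitzWith 1 D)
    (ρ : ℝ → Pk k) (v : ℝ → k.VecRKHS) (t : ℝ) :
    -(G * |deriv l t - √B * ‖v t‖|) ≤
      contIntegrand ρ v (fun p : ℝ × Euc d => g (D p.2 - l p.1)) t := by
  have hgd (s : ℝ) : HasDerivAt g (deriv g s) s := (hg.differentiable (by simp) s).hasDerivAt
  have hld : HasDerivAt l (deriv l t) t := (hl.differentiable (by simp) t).hasDerivAt
  have h1 (x : Euc d) : deriv (fun s => g (D x - l s)) t =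
      -deriv g (D x - l t) * deriv l t := by
    have := (hgd (D x - l t)).comp t (hld.const_sub (D x))
    rw [Function.comp_def] at this
    rw [this.deriv]
    ring
  have h2 (x : Euc d) : gradient (fun y => g (D y - l t)) x = deriv g (D x - l t) • gradient D x := by
    have := (hgd (D x - l t)).comp_hasFDerivAt x
      (((hD.differentiable (by simp) x).hasFDerivAt).sub_const (l t))
    rw [Function.comp_def] at this
    rw [gradient, this.fderiv, map_smulₛₗ]
    rfl
  have hgrad (x : Euc d) : ‖gradient D x‖ ≤ 1 := by
    rw [gradient, LinearIsometryEquiv.norm_map]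
    exact norm_fderiv_le_of_lipschitz ℝ hDl
  have hfield (x : Euc d) : |inner ℝ (gradient D x) (vecField (v t) x)| ≤ √B * ‖v t‖ := by
    refine (abs_real_inner_le_norm _ _).trans ?_
    exact (mul_le_of_le_one_left (norm_nonneg _) (hgrad x)).trans
      (norm_vecField_le_of_bounded hB _ _)
  have hG0 : 0 ≤ G := (abs_nonneg _).trans (hG 0)
  have hgc : Continuous fun x => deriv g (D x - l t) :=
    (hg.continuous_deriv (by simp)).comp (hD.continuous.sub continuous_const)
  have i1 : Integrable (fun x => -deriv g (D x - l t) * deriv l t) (ρ t).meas := by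
    refine Integrable.of_bound (hgc.neg.mul continuous_const).aestronglyMeasurable
      (G * |deriv l t|) (.of_forall fun x => ?_)
    rw [norm_mul, norm_neg]
    exact mul_le_mul_of_nonneg_right (hG _) (norm_nonneg _)
  have i2 : Integrable (fun x => deriv g (D x - l t) *
      inner ℝ (gradient D x) (vecField (v t) x)) (ρ t).meas := by
    refine Integrable.of_bound (hgc.mul
      (hD.continuous_gradient'.inner (continuous_vecField (v t)))).aestronglyMeasurable
      (G * (√B * ‖v t‖)) (.of_forall fun x => ?_)
    rw [norm_mul]
    exact mul_le_mul (hG _) (hfield x) (norm_nonneg _) hG0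
  simp only [contIntegrand, h1, h2, real_inner_smul_left]
  rw [← integral_add i1 i2]
  have h3 : -(G * |deriv l t - √B * ‖v t‖|) =
      ∫ _, -(G * |deriv l t - √B * ‖v t‖|) ∂(ρ t).meas := by simp
  rw [h3]
  refine integral_mono (integrable_const _) (i1.add i2) fun x => ?_
  simp only
  have hneg : deriv g (D x - l t) ≤ 0 := hga.deriv_nonpos
  have hGx := abs_le.1 (hG (D x - l t))
  have hf := abs_le.1 (hfield x)
  have ha := neg_abs_le (deriv l t - √B * ‖v t‖)
  set p := deriv g (D x - l t)
  set z := |deriv l t - √B * ‖v t‖|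
  have hz : 0 ≤ z := abs_nonneg _
  -- The integrand is `p * X` with `X = ⟪∇D, v⟫ - l' ≤ √B ‖v‖ - l' ≤ z`. As `-G ≤ p ≤ 0` and `z ≥
  -- 0`, it is at least `p * z ≥ -G * z`.
  nlinarith [mul_nonneg (neg_nonneg.2 hneg) (sub_nonneg.2 hf.2),
    mul_nonneg (neg_nonneg.2 hneg) (sub_nonneg.2 ha),
    mul_nonneg hz (neg_le_iff_add_nonneg.1 hGx.1)]

/-- For a bounded kernel, curves of finite energy have finite propagation speed. -/
theorem IsFlow.measure_le_thickening (h : IsFlow μ ν ρ v 0 1) {B : ℝ}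
    (hB : ∀ x y, |k x y| ≤ B) {a r : ℝ} (ha : 0 ≤ a) (he : energy v ≤ ENNReal.ofReal a ^ 2)
    (hr : √B * a < r) {A : Set (Euc d)} (hA : Bornology.IsBounded A) :
    μ.meas A ≤ ν.meas (Metric.thickening r A) := by
  rcases A.eq_empty_or_nonempty with rfl | hne
  · simp
  -- The slack `δ` is shared out: `δ/8` for smoothing the distance, the step between `δ/8` and
  -- `δ/4`, and at most `δ/2` for the error in the front position.
  set δ := r - √B * a with hδ
  have hδ0 : 0 < δ := sub_pos.2 hr
  obtain ⟨D, hD, hDl, hDd⟩ := exists_contDiff_lipschitz_near (Metric.lipschitz_infDist_pt A)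
    (show 0 < δ / 8 by positivity)
  obtain ⟨g, hg, hga, hg0, hg1, hgl, hgr, G, hG⟩ :=
    exists_smooth_step (show δ / 8 < δ / 4 by linarith)
  have hG0 : 0 ≤ G := (abs_nonneg _).trans (hG 0)
  have hvi : IntervalIntegrable (fun t => √B * ‖v t‖) volume 0 1 := by
    rw [intervalIntegrable_iff]
    exact ((h.memLp.integrable (by norm_num)).mono_measure
      (Measure.restrict_mono_set _ uIoc_subset_uIcc)).norm.const_mul _
  have hvle : ∫ t in (0 : ℝ)..1, √B * ‖v t‖ ≤ √B * a := by
    rw [intervalIntegral.integral_const_mul]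
    exact mul_le_mul_of_nonneg_left (integral_norm_le_of_energy_le h.memLp ha he)
      (Real.sqrt_nonneg _)
  have key : ∀ η : ℝ, 0 < η → η ≤ δ / 2 →
      μ.meas.real A ≤ ν.meas.real (Metric.thickening r A) + G * η := by
    intro η hη hηδ
    obtain ⟨l, hl, hl0, hle⟩ := exists_contDiff_deriv_near hvi hη
    have hlc : Continuous (deriv l) := hl.continuous_deriv (by simp)
    have hl1 : l 1 ≤ √B * a + η := by
      have e1 : l 1 = ∫ t in (0 : ℝ)..1, deriv l t := by
        rw [intervalIntegral.integral_deriv_eq_sub (fun t _ => hl.differentiable (by simp) t)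
          (hlc.intervalIntegrable _ _), hl0, sub_zero]
      have e2 : ∫ t in (0 : ℝ)..1, deriv l t ≤
          ∫ t in (0 : ℝ)..1, (√B * ‖v t‖ + |deriv l t - √B * ‖v t‖|) := by
        refine intervalIntegral.integral_mono_on zero_le_one (hlc.intervalIntegrable _ _)
          (hvi.add ((hlc.intervalIntegrable _ _).sub hvi).abs) fun t _ => ?_
        linarith [le_abs_self (deriv l t - √B * ‖v t‖)]
      rw [intervalIntegral.integral_add hvi ((hlc.intervalIntegrable _ _).sub hvi).abs] at e2
      linarith
    -- The moving front: it equals one on `A` at time `0` and vanishes outside the `r`-thickening at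
    -- time `1`, since there `D - l 1 ≥ δ - δ/8 - δ/2 > δ/4`.
    let u : ℝ × Euc d → ℝ := fun p => g (D p.2 - l p.1)
    have hu : ContDiff ℝ ∞ u := hg.comp ((hD.comp contDiff_snd).sub (hl.comp contDiff_fst))
    obtain ⟨M, hM⟩ := (isCompact_Icc (a := (-2 : ℝ)) (b := 3)).exists_bound_of_continuousOn
      hl.continuous.continuousOn
    -- Boundedness of `A` enters here: it makes the front compactly supported in space.
    have hK : IsCompact {x : Euc d | Metric.infDist x A ≤ M + δ} := by
      refine Metric.isCompact_of_isClosed_isBounded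
        (isClosed_le (Metric.continuous_infDist_pt A) continuous_const) ?_
      refine (hA.thickening (δ := M + δ + 1)).subset fun x hx => ?_
      obtain ⟨y, hy, hxy⟩ := (Metric.infDist_lt_iff hne).1 (hx.trans_lt (lt_add_one _))
      exact Metric.mem_thickening_iff.2 ⟨y, hy, hxy⟩
    have hz : ∀ t ∈ Icc (-2 : ℝ) 3, ∀ x ∉ {x : Euc d | Metric.infDist x A ≤ M + δ},
        u (t, x) = 0 := by
      intro t ht x hx
      refine hgr _ ?_
      have h1 := (abs_le.1 (hM t ht)).2
      have h2 := (abs_le.1 (hDd x)).1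
      have h3 : M + δ < Metric.infDist x A := not_le.1 hx
      linarith
    obtain ⟨hci, heq⟩ := h.equation_of_isCompact hu hK hz
    have hlow : -(G * η) ≤ ∫ t in (0 : ℝ)..1, contIntegrand ρ v u t := by
      have hai := ((hlc.intervalIntegrable 0 1).sub hvi).abs.const_mul G
      calc -(G * η) ≤ -(G * ∫ t in (0 : ℝ)..1, |deriv l t - √B * ‖v t‖|) :=
            neg_le_neg (mul_le_mul_of_nonneg_left hle hG0)
        _ = ∫ t in (0 : ℝ)..1, -(G * |deriv l t - √B * ‖v t‖|) := by
            rw [intervalIntegral.integral_neg, intervalIntegral.integral_const_mul]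
        _ ≤ _ := intervalIntegral.integral_mono_on zero_le_one hai.neg hci
            fun t _ => contIntegrand_front_ge hB hg hga hG hl hD hDl ρ v t
    have hui (t : ℝ) (σ : Pk k) : Integrable (fun x => u (t, x)) σ.meas :=
      Integrable.of_bound (contDiff_slice hu t).continuous.aestronglyMeasurable 1
        (.of_forall fun x => by
          rw [Real.norm_of_nonneg (hg0 _)]
          exact hg1 _)
    have hμ : μ.meas.real A ≤ ∫ x, u (0, x) ∂μ.meas := by
      -- `A` need not be measurable, but its closure is, and the front equals one there as well.
      calc μ.meas.real A ≤ μ.meas.real (closure A) := measureReal_mono subset_closure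
        _ = ∫ x, (closure A).indicator 1 x ∂μ.meas :=
            (integral_indicator_one isClosed_closure.measurableSet).symm
        _ ≤ _ := by
            refine integral_mono ((integrable_const 1).indicator isClosed_closure.measurableSet)
              (hui 0 μ) fun x => ?_
            by_cases hx : x ∈ closure A
            · have h0 : Metric.infDist x A = 0 := (Metric.mem_closure_iff_infDist_zero hne).1 hx
              have h2 := (abs_le.1 (hDd x)).2
              have : u (0, x) = 1 := hgl _ (by simp only [hl0]; linarith)
              simp [hx, this]
            · simpa [hx] using hg0 _
    have hν : ∫ x, u (1, x) ∂ν.meas ≤ ν.meas.real (Metric.thickening r A) := by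
      rw [← integral_indicator_one Metric.isOpen_thickening.measurableSet]
      refine integral_mono (hui 1 ν)
        ((integrable_const 1).indicator Metric.isOpen_thickening.measurableSet) fun x => ?_
      by_cases hx : x ∈ Metric.thickening r A
      · simpa [hx] using hg1 _
      · have : u (1, x) = 0 := by
          refine hgr _ ?_
          by_contra hlt
          refine hx (Metric.mem_thickening_iff.2 ((Metric.infDist_lt_iff hne).1 ?_))
          have h2 := (abs_le.1 (hDd x)).1
          simp only at hlt
          linarith
        simp [hx, this]
    linarith
  have hfin : μ.meas.real A ≤ ν.meas.real (Metric.thickening r A) := by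
    refine le_of_forall_pos_le_add fun ε hε => ?_
    have h1 := key (min (δ / 2) (ε / (G + 1))) (by positivity) (min_le_left _ _)
    have h2 : G * min (δ / 2) (ε / (G + 1)) ≤ G * (ε / (G + 1)) :=
      mul_le_mul_of_nonneg_left (min_le_right _ _) hG0
    have h3 : G * (ε / (G + 1)) ≤ ε := by
      rw [← mul_div_assoc, div_le_iff₀ (by positivity)]
      nlinarith
    linarith
  exact (ENNReal.toReal_le_toReal (measure_ne_top _ _) (measure_ne_top _ _)).1 hfin

end SteinGeometry

/-! ### From neighbourhood inequalities to couplings, by Hall's theorem on a grid. -/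

namespace SteinGeometry

section Transport

variable {ι : Type*}

/-- A transport version of Hall's marriage theorem with integer supplies and demands. -/
theorem exists_nat_transport [DecidableEq ι] (t : ι → Finset ι) (A B : ι → ℕ)
    (h : ∀ S : Finset ι, ∑ i ∈ S, A i ≤ ∑ j ∈ S.biUnion t, B j) :
    ∃ m : ι → ι → ℕ, (∀ i, ∀ j ∉ t i, m i j = 0) ∧ (∀ i, ∑ j ∈ t i, m i j = A i) ∧
      ∀ j (T : Finset ι), ∑ i ∈ T, m i j ≤ B j := by
  -- Each supply is split into unit sources and each demand into unit slots; an injective choice of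
  -- slots is the transport plan.
  let t' : (Σ i, Fin (A i)) → Finset (Σ j, Fin (B j)) := fun p =>
    (t p.1).sigma fun _ => Finset.univ
  obtain ⟨f, hf, hft⟩ := (Finset.all_card_le_biUnion_card_iff_exists_injective t').1 fun s => by
    have h1 : s ⊆ (s.image Sigma.fst).sigma fun _ => Finset.univ := fun p hp => by
      simp only [Finset.mem_sigma, Finset.mem_univ, and_true]
      exact Finset.mem_image_of_mem _ hp
    have h2 : ((s.image Sigma.fst).biUnion t).sigma (fun _ => Finset.univ) ⊆ s.biUnion t' := by
      rintro ⟨j, q⟩ hq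
      simp only [Finset.mem_sigma, Finset.mem_biUnion, Finset.mem_image, Finset.mem_univ,
        and_true] at hq
      obtain ⟨i, ⟨p, hp, rfl⟩, hj⟩ := hq
      exact Finset.mem_biUnion.2 ⟨p, hp, by simpa [t'] using hj⟩
    calc s.card ≤ ∑ i ∈ s.image Sigma.fst, A i := by
          simpa using Finset.card_le_card h1
      _ ≤ ∑ j ∈ (s.image Sigma.fst).biUnion t, B j := h _
      _ ≤ _ := by simpa using Finset.card_le_card h2
  have hft' (i : ι) (p : Fin (A i)) : (f ⟨i, p⟩).1 ∈ t i := by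
    simpa [t'] using hft ⟨i, p⟩
  refine ⟨fun i j => (Finset.univ.filter fun p : Fin (A i) => (f ⟨i, p⟩).1 = j).card,
    fun i j hj => ?_, fun i => ?_, fun j T => ?_⟩
  · rw [Finset.card_eq_zero, Finset.filter_eq_empty_iff]
    rintro p - rfl
    exact hj (hft' i p)
  · rw [← Finset.card_eq_sum_card_fiberwise (f := fun p : Fin (A i) => (f ⟨i, p⟩).1)
      (s := Finset.univ) fun p _ => hft' i p]
    simp
  · rw [← Finset.card_sigma]
    have : (({j} : Finset ι).sigma fun j => (Finset.univ : Finset (Fin (B j)))).card = B j := by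
      simp
    rw [← this]
    refine Finset.card_le_card_of_injOn f (fun p hp => ?_) hf.injOn
    simpa using (by simpa using hp : p.1 ∈ T ∧ (f p).1 = j).2

/-- A transport version of Hall's marriage theorem with real supplies and demands. -/
theorem exists_real_transport [DecidableEq ι] (t : ι → Finset ι) (a b : ι → ℝ)
    (ha : ∀ i, 0 ≤ a i) (hb : ∀ i, 0 ≤ b i)
    (h : ∀ S : Finset ι, ∑ i ∈ S, a i ≤ ∑ j ∈ S.biUnion t, b j) :
    ∃ m : ι → ι → ℝ, (∀ i j, 0 ≤ m i j) ∧ (∀ i, ∀ j ∉ t i, m i j = 0) ∧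
      (∀ i, ∑ j ∈ t i, m i j = a i) ∧ ∀ j (T : Finset ι), ∑ i ∈ T, m i j ≤ b j := by
  -- Rounding supplies down and demands up preserves Hall's condition after scaling by `n`.
  have hn (n : ℕ) (S : Finset ι) :
      ∑ i ∈ S, ⌊a i * n⌋₊ ≤ ∑ j ∈ S.biUnion t, ⌈b j * n⌉₊ := by
    have : ((∑ i ∈ S, ⌊a i * n⌋₊ : ℕ) : ℝ) ≤ (∑ j ∈ S.biUnion t, ⌈b j * n⌉₊ : ℕ) := by
      push_cast
      calc ∑ i ∈ S, (⌊a i * n⌋₊ : ℝ) ≤ ∑ i ∈ S, a i * n :=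
            Finset.sum_le_sum fun i _ => Nat.floor_le (mul_nonneg (ha i) n.cast_nonneg)
        _ ≤ ∑ j ∈ S.biUnion t, b j * n := by
            rw [← Finset.sum_mul, ← Finset.sum_mul]
            exact mul_le_mul_of_nonneg_right (h S) n.cast_nonneg
        _ ≤ _ := Finset.sum_le_sum fun j _ => Nat.le_ceil _
    exact_mod_cast this
  choose m hm0 hm1 hm2 using fun n : ℕ => exists_nat_transport t _ _ (hn n)
  -- A limit along an ultrafilter exists for all pairs `i j` at once, with no diagonal extraction.
  let U := Filter.hyperfilter ℕ
  have hbd (i j : ι) (n : ℕ) : (m n i j : ℝ) / n ∈ Icc 0 (a i) := by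
    refine ⟨by positivity, ?_⟩
    have h1 : m n i j ≤ ⌊a i * n⌋₊ := by
      by_cases hj : j ∈ t i
      · rw [← hm1 n i]
        exact Finset.single_le_sum (f := fun j => m n i j) (fun _ _ => Nat.zero_le _) hj
      · rw [hm0 n i j hj]
        exact Nat.zero_le _
    have h2 : (m n i j : ℝ) ≤ a i * n :=
      (Nat.cast_le.2 h1).trans (Nat.floor_le (mul_nonneg (ha i) n.cast_nonneg))
    exact div_le_of_le_mul₀ n.cast_nonneg (ha i) h2
  have hlim (i j : ι) : ∃ x ∈ Icc 0 (a i),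
      Filter.Tendsto (fun n => (m n i j : ℝ) / n) U (nhds x) :=
    isCompact_Icc.ultrafilter_le_nhds (U.map fun n => (m n i j : ℝ) / n)
      (Filter.tendsto_principal.2 (.of_forall fun n => hbd i j n))
  choose w hw hwt using hlim
  have hU : (U : Filter ℕ) ≤ Filter.atTop := Nat.hyperfilter_le_atTop
  have hcast : Filter.Tendsto (fun n : ℕ => (n : ℝ)) U Filter.atTop :=
    tendsto_natCast_atTop_atTop.mono_left hU
  refine ⟨w, fun i j => (hw i j).1, fun i j hj => ?_, fun i => ?_, fun j T => ?_⟩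
  · refine tendsto_nhds_unique (hwt i j) ?_
    simp [hm0 _ i j hj]
  · refine tendsto_nhds_unique (tendsto_finsetSum _ fun j _ => hwt i j) ?_
    refine ((tendsto_nat_floor_mul_div_atTop (ha i)).comp hcast).congr fun n => ?_
    rw [Function.comp_apply, ← hm1 n i, ← Finset.sum_div]
    push_cast
    rfl
  · refine le_of_tendsto_of_tendsto' (tendsto_finsetSum _ fun i _ => hwt i j)
      ((tendsto_nat_ceil_mul_div_atTop (hb j)).comp hcast) fun n => ?_
    rw [Function.comp_apply, ← Finset.sum_div]
    refine div_le_div_of_nonneg_right ?_ n.cast_nonneg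
    exact_mod_cast hm2 n j T

/-- Gluing a transport plan between the cells of a countable partition to a coupling. -/
theorem exists_coupling_of_transport {X : Type*} [MeasurableSpace X] [Countable ι]
    (μ ν : Measure X) [IsProbabilityMeasure μ] [IsProbabilityMeasure ν] {A : ι → Set X}
    (hA : ∀ i, MeasurableSet (A i)) (hd : Pairwise (Function.onFun Disjoint A))
    (hU : ⋃ i, A i = univ) (w : ι → ι → ENNReal) (h1 : ∀ i, ∑' j, w i j = μ (A i))
    (h2 : ∀ j, ∑' i, w i j ≤ ν (A j)) :
    ∃ γ : Measure (X × X), γ.map Prod.fst = μ ∧ γ.map Prod.snd = ν ∧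
      ∀ᵐ p ∂γ, ∃ i j, w i j ≠ 0 ∧ p.1 ∈ A i ∧ p.2 ∈ A j := by
  have hw1 (i j : ι) : w i j ≤ μ (A i) := h1 i ▸ ENNReal.le_tsum j
  have hw2 (i j : ι) : w i j ≤ ν (A j) := (ENNReal.le_tsum i).trans (h2 j)
  -- The weight that gives the product block `A i × A j` mass `w i j`. If a factor of the
  -- denominator is null then `w i j = 0`, and the quotient is `0` in `ENNReal`.
  let c (i j : ι) : ENNReal := w i j / (μ (A i) * ν (A j))
  have hc1 (i j : ι) : c i j * ν (A j) = w i j / μ (A i) := by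
    by_cases h : ν (A j) = 0
    · have : w i j = 0 := le_antisymm (h ▸ hw2 i j) zero_le
      simp [h, this]
    · simp only [c]
      rw [ENNReal.div_eq_inv_mul, ENNReal.div_eq_inv_mul,
        ENNReal.mul_inv (.inr (measure_ne_top _ _)) (.inl (measure_ne_top _ _))]
      calc _ = (ν (A j))⁻¹ * ν (A j) * ((μ (A i))⁻¹ * w i j) := by ring
        _ = _ := by rw [ENNReal.inv_mul_cancel h (measure_ne_top _ _), one_mul]
  have hc2 (i j : ι) : c i j * μ (A i) = w i j / ν (A j) := by
    by_cases h : μ (A i) = 0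
    · have : w i j = 0 := le_antisymm (h ▸ hw1 i j) zero_le
      simp [h, this]
    · simp only [c]
      rw [ENNReal.div_eq_inv_mul, ENNReal.div_eq_inv_mul,
        ENNReal.mul_inv (.inr (measure_ne_top _ _)) (.inl (measure_ne_top _ _))]
      calc _ = (μ (A i))⁻¹ * μ (A i) * ((ν (A j))⁻¹ * w i j) := by ring
        _ = _ := by rw [ENNReal.inv_mul_cancel h (measure_ne_top _ _), one_mul]
  let γ : Measure (X × X) := Measure.sum fun i => Measure.sum fun j =>
    c i j • (μ.restrict (A i)).prod (ν.restrict (A j))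
  have hγ {E : Set (X × X)} (hE : MeasurableSet E) : γ E = ∑' i, ∑' j,
      c i j * ((μ.restrict (A i)).prod (ν.restrict (A j))) E := by
    simp only [γ, Measure.sum_apply _ hE, Measure.smul_apply, smul_eq_mul]
  have part (m : Measure X) {E : Set X} (hE : MeasurableSet E) : ∑' i, m (E ∩ A i) = m E := by
    rw [← measure_iUnion (fun i j hij => (hd hij).mono inter_subset_right inter_subset_right)
      fun i => hE.inter (hA i), ← inter_iUnion, hU, inter_univ]
  have hfst : γ.map Prod.fst = μ := by
    ext E hE
    rw [Measure.map_apply measurable_fst hE, hγ (measurable_fst hE), ← part μ hE]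
    refine tsum_congr fun i => ?_
    have e (j : ι) : c i j * ((μ.restrict (A i)).prod (ν.restrict (A j))) (Prod.fst ⁻¹' E) =
        w i j * ((μ (A i))⁻¹ * μ (E ∩ A i)) := by
      rw [← prod_univ, Measure.prod_prod, Measure.restrict_apply hE, Measure.restrict_apply_univ,
        mul_comm (μ _), ← mul_assoc, hc1, div_eq_mul_inv, mul_assoc]
    simp_rw [e]
    rw [ENNReal.tsum_mul_right, h1, ← mul_assoc]
    by_cases h : μ (A i) = 0
    · rw [measure_mono_null inter_subset_right h, mul_zero]
    · rw [ENNReal.mul_inv_cancel h (measure_ne_top _ _), one_mul]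
  have hγp : IsProbabilityMeasure γ := by
    refine ⟨?_⟩
    rw [← preimage_univ (f := Prod.fst), ← Measure.map_apply measurable_fst .univ, hfst,
      measure_univ]
  have hsnd : γ.map Prod.snd = ν := by
    have : IsProbabilityMeasure (γ.map Prod.snd) :=
      Measure.isProbabilityMeasure_map measurable_snd.aemeasurable
    -- Demands are only bounded above, but an inequality between probability measures is an
    -- equality.
    refine Measure.eq_of_le_of_isProbabilityMeasure (Measure.le_iff.2 fun E hE => ?_)
    rw [Measure.map_apply measurable_snd hE, hγ (measurable_snd hE), ← part ν hE,
      ENNReal.tsum_comm]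
    refine ENNReal.tsum_le_tsum fun j => ?_
    have e (i : ι) : c i j * ((μ.restrict (A i)).prod (ν.restrict (A j))) (Prod.snd ⁻¹' E) =
        w i j * ((ν (A j))⁻¹ * ν (E ∩ A j)) := by
      rw [← univ_prod, Measure.prod_prod, Measure.restrict_apply hE, Measure.restrict_apply_univ,
        ← mul_assoc, hc2, div_eq_mul_inv, mul_assoc]
    simp_rw [e]
    rw [ENNReal.tsum_mul_right, ← mul_assoc]
    refine mul_le_of_le_one_left' ?_
    exact (mul_le_mul_left (h2 j) _).trans (ENNReal.mul_inv_le_one _)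
  refine ⟨γ, hfst, hsnd, ?_⟩
  simp only [γ, Measure.ae_sum_iff]
  intro i j
  by_cases h : w i j = 0
  · simp [c, h]
  · refine Measure.ae_smul_measure ?_ _
    rw [Measure.prod_restrict]
    filter_upwards [ae_restrict_mem ((hA i).prod (hA j))] with p hp
    exact ⟨i, j, h, hp.1, hp.2⟩

end Transport

section Grid

variable {d : ℕ}

/-- The index of the grid cell of side `r` containing `x`. -/
noncomputable def gridIndex (r : ℝ) (x : Euc d) : Fin d → ℤ := fun l => ⌊x l / r⌋

theorem measurable_gridIndex (r : ℝ) : Measurable (gridIndex (d := d) r) :=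
  measurable_pi_lambda _ fun l => Int.measurable_floor.comp
    (by fun_prop : Measurable fun x : Euc d => x l / r)

theorem gridIndex_mem_Icc {r : ℝ} (hr : 0 < r) {x y : Euc d} (h : dist y x < r) :
    gridIndex r y ∈ Finset.Icc (gridIndex r x - 1) (gridIndex r x + 1) := by
  have h1 (l : Fin d) : |y l / r - x l / r| < 1 := by
    rw [← sub_div, abs_div, abs_of_pos hr, div_lt_one hr]
    refine lt_of_le_of_lt ?_ h
    rw [dist_eq_norm]
    exact PiLp.norm_apply_le (y - x) l
  rw [Finset.mem_Icc]
  constructor <;> intro l <;> have h2 := abs_lt.1 (h1 l) <;>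
    simp only [gridIndex, Pi.sub_apply, Pi.add_apply, Pi.one_apply]
  · rw [Int.le_floor]
    push_cast
    linarith [Int.floor_le (x l / r)]
  · rw [← Int.lt_add_one_iff, Int.floor_lt]
    push_cast
    linarith [Int.lt_floor_add_one (x l / r)]

theorem dist_le_of_gridIndex_mem_Icc {r : ℝ} (hr : 0 < r) {x y : Euc d}
    (h : gridIndex r y ∈ Finset.Icc (gridIndex r x - 1) (gridIndex r x + 1)) :
    dist x y ≤ √d * (2 * r) := by
  rw [Finset.mem_Icc] at h
  have h1 (l : Fin d) : dist (x l) (y l) ≤ 2 * r := by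
    have h2 : ⌊x l / r⌋ - 1 ≤ ⌊y l / r⌋ := h.1 l
    have h3 : ⌊y l / r⌋ ≤ ⌊x l / r⌋ + 1 := h.2 l
    have h2' : ((⌊x l / r⌋ : ℝ) - 1) ≤ ⌊y l / r⌋ := by exact_mod_cast h2
    have h3' : (⌊y l / r⌋ : ℝ) ≤ ⌊x l / r⌋ + 1 := by exact_mod_cast h3
    have : |x l / r - y l / r| ≤ 2 := by
      rw [abs_le]
      constructor <;> linarith [Int.floor_le (x l / r), Int.lt_floor_add_one (x l / r),
        Int.floor_le (y l / r), Int.lt_floor_add_one (y l / r)]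
    rwa [← sub_div, abs_div, abs_of_pos hr, div_le_iff₀ hr] at this
  rw [EuclideanSpace.dist_eq]
  calc √(∑ l, dist (x l) (y l) ^ 2) ≤ √(∑ _ : Fin d, (2 * r) ^ 2) :=
        Real.sqrt_le_sqrt (Finset.sum_le_sum fun l _ => by gcongr; exact h1 l)
    _ = √d * (2 * r) := by
        rw [Finset.sum_const, Finset.card_univ, Fintype.card_fin, nsmul_eq_mul,
          Real.sqrt_mul (Nat.cast_nonneg d), Real.sqrt_sq (by positivity)]

theorem isBounded_gridIndex_preimage {r : ℝ} (hr : 0 < r) (i : Fin d → ℤ) :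
    Bornology.IsBounded (gridIndex r ⁻¹' {i}) := by
  refine Metric.isBounded_iff.2 ⟨√d * (2 * r), fun x hx y hy => ?_⟩
  refine dist_le_of_gridIndex_mem_Icc hr ?_
  rw [mem_singleton_iff.1 hx, mem_singleton_iff.1 hy, Finset.mem_Icc]
  exact ⟨sub_le_self _ zero_le_one, le_add_of_nonneg_right zero_le_one⟩

/-- A crude form of Strassen's theorem. -/
theorem W2_le_of_forall_measure_le_thickening (μ ν : Measure (Euc d)) [IsProbabilityMeasure μ]
    [IsProbabilityMeasure ν] {r : ℝ} (hr : 0 < r)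
    (h : ∀ A : Set (Euc d), Bornology.IsBounded A → μ A ≤ ν (Metric.thickening r A)) :
    W2 μ ν ≤ ENNReal.ofReal (√d * (2 * r)) := by
  classical
  let A : (Fin d → ℤ) → Set (Euc d) := fun i => gridIndex r ⁻¹' {i}
  have hA (i) : MeasurableSet (A i) := measurable_gridIndex r (measurableSet_singleton i)
  have hd : Pairwise (Function.onFun Disjoint A) := fun i j hij =>
    Disjoint.preimage _ (disjoint_singleton.2 hij)
  have hU : ⋃ i, A i = univ := by
    rw [← preimage_iUnion, iUnion_of_singleton, preimage_univ]
  -- The neighbouring cells of `i`, itself included, cover the `r`-thickening of that cell, so the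
  -- hypothesis on unions of cells is Hall's condition.
  let t : (Fin d → ℤ) → Finset (Fin d → ℤ) := fun i => Finset.Icc (i - 1) (i + 1)
  have hsum (m : Measure (Euc d)) [IsProbabilityMeasure m] (S : Finset (Fin d → ℤ)) :
      ∑ i ∈ S, m.real (A i) = m.real (⋃ i ∈ S, A i) :=
    (measureReal_biUnion_finset (fun i _ j _ hij => hd hij) fun i _ => hA i).symm
  obtain ⟨w, hw0, hwt, hw1, hw2⟩ := exists_real_transport t (fun i => μ.real (A i))
    (fun i => ν.real (A i)) (fun _ => measureReal_nonneg) (fun _ => measureReal_nonneg) fun S => by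
      rw [hsum, hsum]
      have hb : Bornology.IsBounded (⋃ i ∈ S, A i) :=
        (Bornology.isBounded_biUnion_finset S).2 fun i _ => isBounded_gridIndex_preimage hr i
      refine ENNReal.toReal_mono (measure_ne_top _ _) ((h _ hb).trans (measure_mono fun y hy => ?_))
      obtain ⟨x, hx, hxy⟩ := Metric.mem_thickening_iff.1 hy
      obtain ⟨i, hi, hxi⟩ := mem_iUnion₂.1 hx
      refine mem_iUnion₂.2 ⟨gridIndex r y, Finset.mem_biUnion.2 ⟨i, hi, ?_⟩, rfl⟩
      rw [← mem_singleton_iff.1 hxi]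
      exact gridIndex_mem_Icc hr hxy
  obtain ⟨γ, hγ1, hγ2, hγ⟩ := exists_coupling_of_transport μ ν hA hd hU
    (fun i j => ENNReal.ofReal (w i j))
    (fun i => by
      rw [tsum_eq_sum (s := t i) fun j hj => by rw [hwt i j hj, ENNReal.ofReal_zero],
        ← ENNReal.ofReal_sum_of_nonneg fun j _ => hw0 i j, hw1, ofReal_measureReal])
    (fun j => by
      rw [ENNReal.tsum_eq_iSup_sum]
      refine iSup_le fun T => ?_
      rw [← ENNReal.ofReal_sum_of_nonneg fun i _ => hw0 i j]
      exact (ENNReal.ofReal_le_ofReal (hw2 j T)).trans (le_of_eq ofReal_measureReal))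
  have : IsProbabilityMeasure γ := by
    refine ⟨?_⟩
    rw [← preimage_univ (f := Prod.fst), ← Measure.map_apply measurable_fst .univ, hγ1,
      measure_univ]
  have hcost : ∫⁻ p, edist p.1 p.2 ^ 2 ∂γ ≤ ENNReal.ofReal (√d * (2 * r)) ^ 2 := by
    calc ∫⁻ p, edist p.1 p.2 ^ 2 ∂γ ≤ ∫⁻ _, ENNReal.ofReal (√d * (2 * r)) ^ 2 ∂γ := by
          refine lintegral_mono_ae ?_
          filter_upwards [hγ] with p hp
          obtain ⟨i, j, hij, hi, hj⟩ := hp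
          gcongr
          rw [edist_dist]
          refine ENNReal.ofReal_le_ofReal (dist_le_of_gridIndex_mem_Icc hr ?_)
          rw [mem_singleton_iff.1 hi, mem_singleton_iff.1 hj]
          by_contra hn
          exact hij (by rw [hwt i j hn, ENNReal.ofReal_zero])
      _ = _ := by simp
  calc W2 μ ν ≤ (ENNReal.ofReal (√d * (2 * r)) ^ 2) ^ (1 / 2 : ℝ) :=
        ENNReal.rpow_le_rpow (iInf₂_le_of_le γ hγ1 (iInf_le_of_le hγ2 hcost)) (by norm_num)
    _ = _ := by
        rw [← ENNReal.rpow_natCast, ← ENNReal.rpow_mul]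
        norm_num

end Grid

end SteinGeometry

/-! ### Comparison with `W2` and with weak convergence. -/

namespace SteinGeometry

variable {d : ℕ} {k : PDKernel d} {μ ν : Pk k}

theorem measure_le_thickening_of_steinDist_lt {B : ℝ} (hB : ∀ x y, |k x y| ≤ B) {a r : ℝ}
    (ha : 0 ≤ a) (h : steinDist k μ ν < ENNReal.ofReal a) (hr : √B * a < r) {A : Set (Euc d)}
    (hA : Bornology.IsBounded A) : μ.meas A ≤ ν.meas (Metric.thickening r A) := by
  obtain ⟨ρ, v, hf, he⟩ := exists_isFlow_of_steinDist_lt h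
  exact hf.measure_le_thickening hB ha he.le hr hA

theorem W2_le_steinDist {B : ℝ} (hB : ∀ x y, |k x y| ≤ B) (μ ν : Pk k) :
    W2 μ.meas ν.meas ≤ ENNReal.ofReal (√d * (2 * (√B + 1)) + 1) * steinDist k μ ν := by
  -- The extra `1` keeps the constant positive when `d = 0`, which also avoids `0 * ⊤`. The `+ 1`
  -- next to `√B` supplies the strict inequality `√B * a < r`.
  have hC : 0 < √d * (2 * (√B + 1)) + 1 := by positivity
  rcases eq_or_ne (steinDist k μ ν) ⊤ with htop | htop
  · rw [htop, ENNReal.mul_top (ENNReal.ofReal_pos.2 hC).ne']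
    exact le_top
  have key : ∀ a : ℝ, steinDist k μ ν < ENNReal.ofReal a →
      W2 μ.meas ν.meas ≤ ENNReal.ofReal ((√d * (2 * (√B + 1)) + 1) * a) := by
    intro a ha
    have ha0 : 0 < a := ENNReal.ofReal_pos.1 (zero_le.trans_lt ha)
    have hr : √B * a < (√B + 1) * a := by linarith
    refine (W2_le_of_forall_measure_le_thickening _ _ (r := (√B + 1) * a) (by positivity)
      fun A hA => measure_le_thickening_of_steinDist_lt hB ha0.le ha hr hA).trans ?_
    refine ENNReal.ofReal_le_ofReal ?_
    linarith
  have hlim : Filter.Tendsto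
      (fun a : ℝ => ENNReal.ofReal ((√d * (2 * (√B + 1)) + 1) * a))
      (nhdsWithin (steinDist k μ ν).toReal (Ioi (steinDist k μ ν).toReal))
      (nhds (ENNReal.ofReal ((√d * (2 * (√B + 1)) + 1) * (steinDist k μ ν).toReal))) := by
    exact ((ENNReal.continuous_ofReal.comp (continuous_const_mul _)).tendsto _).mono_left
      nhdsWithin_le_nhds
  have h1 := ge_of_tendsto hlim (b := W2 μ.meas ν.meas) (by
    filter_upwards [self_mem_nhdsWithin] with a ha
    exact key a ((ENNReal.lt_ofReal_iff_toReal_lt htop).2 ha))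
  rwa [ENNReal.ofReal_mul hC.le, ENNReal.ofReal_toReal htop] at h1

/-- Exhausting a set by its intersections with balls removes the boundedness restriction. -/
theorem levyProkhorovEDist_le_of_forall_isBounded {μ ν : Measure (Euc d)} [IsProbabilityMeasure μ]
    [IsProbabilityMeasure ν] {r : ℝ} (hr : 0 < r)
    (h : ∀ A : Set (Euc d), Bornology.IsBounded A → μ A ≤ ν (Metric.thickening r A))
    (h' : ∀ A : Set (Euc d), Bornology.IsBounded A → ν A ≤ μ (Metric.thickening r A)) :
    levyProkhorovEDist μ ν ≤ ENNReal.ofReal r := by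
  have key (μ ν : Measure (Euc d)) [IsProbabilityMeasure μ] [IsProbabilityMeasure ν]
      (h : ∀ A : Set (Euc d), Bornology.IsBounded A → μ A ≤ ν (Metric.thickening r A))
      (A : Set (Euc d)) : μ A ≤ ν (Metric.thickening r A) := by
    have hA : A = ⋃ n : ℕ, A ∩ Metric.closedBall 0 n := by
      rw [← inter_iUnion, Metric.iUnion_closedBall_nat, inter_univ]
    have hmono : Monotone fun n : ℕ => A ∩ Metric.closedBall (0 : Euc d) n := fun m n hmn =>
      inter_subset_inter_right _ (Metric.closedBall_subset_closedBall (by exact_mod_cast hmn))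
    conv_lhs => rw [hA]
    rw [hmono.measure_iUnion]
    refine iSup_le fun n => (h _ (Metric.isBounded_closedBall.subset inter_subset_right)).trans ?_
    exact measure_mono (Metric.thickening_subset_of_subset _ inter_subset_left)
  refine levyProkhorovEDist_le_of_forall _ _ _ fun ε A hε hεtop _ => ?_
  have hle : r ≤ ε.toReal := ((ENNReal.ofReal_lt_iff_lt_toReal hr.le hεtop.ne).1 hε).le
  constructor
  · exact ((key μ ν h A).trans (measure_mono (Metric.thickening_mono hle _))).trans le_self_add
  · exact ((key ν μ h' A).trans (measure_mono (Metric.thickening_mono hle _))).trans le_self_add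

/-- A weakly open set is open for the Lévy–Prokhorov metric, so it contains a metric ball of some
radius above `r`. A Stein ball of radius `r / (√B + 1)` lies inside it, because mass then travels
less than `r`. -/
theorem steinTopology_le_weakTopology {B : ℝ} (hB : ∀ x y, |k x y| ≤ B) :
    steinTopology k ≤ weakTopology k := by
  rintro _ ⟨V, hV, rfl⟩ μ hμ
  have hc := LevyProkhorov.continuous_toMeasure_probabilityMeasure (Ω := Euc d)
  have hW := hV.preimage hc
  obtain ⟨δ, hδ, hball⟩ := EMetric.isOpen_iff.1 hW (LevyProkhorov.ofMeasure μ.1) hμ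
  obtain ⟨r, hr0, hrδ⟩ := ENNReal.lt_iff_exists_nnreal_btwn.1 hδ
  have hr : 0 < (r : ℝ) := by exact_mod_cast hr0
  refine ⟨ENNReal.ofReal (r / (√B + 1)), ENNReal.ofReal_pos.2 (by positivity), fun ν hν => ?_⟩
  have hlt : √B * (r / (√B + 1)) < r := by
    rw [← mul_div_assoc, div_lt_iff₀ (by positivity)]
    nlinarith
  have hle : levyProkhorovEDist ν.meas μ.meas ≤ ENNReal.ofReal r :=
    levyProkhorovEDist_le_of_forall_isBounded hr
      (fun A hA => measure_le_thickening_of_steinDist_lt hB (by positivity)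
        (by rwa [steinDist_comm]) hlt hA)
      (fun A hA => measure_le_thickening_of_steinDist_lt hB (by positivity) hν hlt hA)
  have hmem : LevyProkhorov.ofMeasure ν.1 ∈ Metric.eball (LevyProkhorov.ofMeasure μ.1) δ := by
    rw [Metric.mem_eball, LevyProkhorov.edist_probabilityMeasure_def]
    refine lt_of_le_of_lt hle ?_
    rwa [ENNReal.ofReal_coe_nnreal]
  exact hball hmem

end SteinGeometry

theorem lemma4p6 (d : ℕ) (k : SteinGeometry.PDKernel d) :
    -- the Stein distance is an extended metric
    ((∀ μ ν : SteinGeometry.Pk k, 0 ≤ SteinGeometry.steinDist k μ ν) ∧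
      (∀ μ ν : SteinGeometry.Pk k,
        SteinGeometry.steinDist k μ ν = SteinGeometry.steinDist k ν μ) ∧
      (∀ μ ν : SteinGeometry.Pk k, SteinGeometry.steinDist k μ ν = 0 ↔ μ = ν) ∧
      (∀ μ₁ μ₂ μ₃ : SteinGeometry.Pk k, SteinGeometry.steinDist k μ₁ μ₃ ≤
        SteinGeometry.steinDist k μ₁ μ₂ + SteinGeometry.steinDist k μ₂ μ₃)) ∧
    -- comparison with the quadratic Wasserstein distance, and of the topologies
    ((∃ B : ℝ, ∀ x y : SteinGeometry.Euc d, |k x y| ≤ B) →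
      (∃ C : ℝ, 0 < C ∧ ∀ μ ν : SteinGeometry.Pk k,
        SteinGeometry.W2 μ.meas ν.meas ≤ ENNReal.ofReal C * SteinGeometry.steinDist k μ ν) ∧
      SteinGeometry.steinTopology k ≤ SteinGeometry.weakTopology k) ∧
    -- the tangency constraint can be dropped
    (∀ μ ν : SteinGeometry.Pk k, SteinGeometry.steinDist k μ ν ^ 2 =
      ⨅ (ρ : ℝ → SteinGeometry.Pk k) (v : ℝ → k.VecRKHS)
        (_ : SteinGeometry.IsConnecting μ ν ρ v), SteinGeometry.energy v) := by
  refine ⟨⟨fun _ _ => zero_le, SteinGeometry.steinDist_comm k,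
    fun _ _ => SteinGeometry.steinDist_eq_zero_iff, SteinGeometry.steinDist_triangle k⟩, ?_,
    SteinGeometry.steinDist_sq k⟩
  rintro ⟨B, hB⟩
  exact ⟨⟨_, by positivity, SteinGeometry.W2_le_steinDist hB⟩,
    SteinGeometry.steinTopology_le_weakTopology hB⟩
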